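/- Let $X$ be a (real or complex) Banach space, $1<\alpha<2$, $r>0$, and put $g_\beta(t)=t^{\beta-1}/\Gamma(\beta)$ for $\beta>0$, $t>0$, and $(g_\beta*h)(t)=\int_0^t g_\beta(t-s)h(s)\,ds$. Let $A$ be a closed, densely defined linear operator on $X$ generating an $\alpha$-times resolvent family $\{S_\alpha(t)\}_{t\ge0}\subset B(X)$; that is, $S_\alpha$ is strongly continuous on $[0,\infty)$, $S_\alpha(0)=I$, and for all $x\in D(A)$ and $t\ge0$ one has $S_\alpha(t)x\in D(A)$, $AS_\alpha(t)x=S_\alpha(t)Ax$ and $S_\alpha(t)x=x+\int_0^t g_\alpha(t-s)S_\alpha(s)Ax\,ds$. Put $P_\alpha(t)z=\int_0^t g_{\alpha-1}(t-s)S_\alpha(s)z\,ds$ for $z\in X$. For $x,y\in D(A)$ and $f\in C([0,r];X)$ consider the problem $$\mathbf D_t^\alpha u(t)=Au(t)+f(t)\quad(t\in[0,r]),\qquad u(0)=x,\quad u'(0)=y, \qquad (*)$$ with the Caputo derivative $\mathbf D_t^\alpha u=\frac{d^2}{dt^2}\bigl[g_{2-\alpha}*(u-u(0)-u'(0)g_2)\bigr]$.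 A strong solution of $(*)$ is a function $u\in C([0,r];D(A))\cap C^1([0,r];X)$, where $D(A)$ carries the graph norm, such that $g_{2-\alpha}*(u-x-g_2y)\in C^2([0,r];X)$ and $(*)$ holds on $[0,r]$. The family $S_\alpha$ is of bounded semivariation on $[0,r]$ if $$\sup\Bigl\|\sum_{i=1}^n\bigl[S_\alpha(d_i)-S_\alpha(d_{i-1})\bigr]x_i\Bigr\|<\infty,$$ the supremum being over all subdivisions $0=d_0<d_1<\cdots<d_n=r$ and all $x_1,\dots,x_n\in X$ with $\|x_i\|\le1$. Theorem. The function $$u(t)=S_\alpha(t)x+\int_0^tS_\alpha(s)y\,ds+\int_0^tP_\alpha(t-s)f(s)\,ds$$ is a strong solution of $(*)$ for all $x,y\in D(A)$ and all $f\in C([0,r];X)$ if and only if $S_\alpha$ is of bounded semivariation on $[0,r]$. Likewise, problem $(*)$ has maximal regularity on $C([0,r];X)$, meaning that for all $x,y\in D(A)$ and all $f\in C([0,r];X)$ it has a unique strong solution, if and only if $S_\alpha$ is of bounded semivariation on $[0,r]$. -/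

import Mathlib

open Set

/-- The kernel `g_β(t) = t^(β-1) / Γ(β)`, used for `β > 0` and `t > 0`. -/
noncomputable def fracKernel (β t : ℝ) : ℝ := t ^ (β - 1) / Real.Gamma β

/-- The convolution `(g_β * f)(t) = ∫₀ᵗ g_β(t - s) f(s) ds`. -/
noncomputable def fracConv {X : Type*} [NormedAddCommGroup X] [NormedSpace ℝ X]
    (β : ℝ) (f : ℝ → X) (t : ℝ) : X :=
  ∫ s in (0 : ℝ)..t, fracKernel β (t - s) • f s

/-- The Caputo derivative of order `α ∈ (1,2)` on `[0,r]`, in its relaxed form: the second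
derivative of `g_{2-α} * (u - u(0) - u'(0) g_2)`, where `g_2(t) = t`. The derivatives are taken
within `[0,r]`, hence one-sided at the end points. -/
noncomputable def caputoDeriv {X : Type*} [NormedAddCommGroup X] [NormedSpace ℝ X]
    (α r : ℝ) (u : ℝ → X) (t : ℝ) : X :=
  iteratedDerivWithin 2
    (fracConv (2 - α) (fun s => u s - u 0 - s • derivWithin u (Icc 0 r) 0)) (Icc 0 r) t

/-- `S`, of which only the values `S t` with `0 ≤ t` matter, is an `α`-times resolvent family
generated by the closed densely defined operator `A`. -/
structure IsResolventFamily {𝕜 X : Type*} [RCLike 𝕜] [NormedAddCommGroup X]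
    [NormedSpace ℝ X] [NormedSpace 𝕜 X]
    (α : ℝ) (A : X →ₗ.[𝕜] X) (S : ℝ → X →L[𝕜] X) : Prop where
  isClosed : A.IsClosed
  dense_domain : Dense (A.domain : Set X)
  strongly_continuous : ∀ x : X, ContinuousOn (fun t => S t x) (Ici 0)
  map_zero : S 0 = ContinuousLinearMap.id 𝕜 X
  commutes : ∀ t : ℝ, 0 ≤ t → ∀ x : A.domain,
    ∃ h : S t x ∈ A.domain, A ⟨S t x, h⟩ = S t (A x)
  resolvent_eq : ∀ t : ℝ, 0 ≤ t → ∀ x : A.domain,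
    S t x = (x : X) + fracConv α (fun s => S s (A x)) t

/-- `P_α(t) x = (g_{α-1} * S)(t) x = ∫₀ᵗ g_{α-1}(t - s) S(s) x ds`. -/
noncomputable def resolventP {𝕜 X : Type*} [RCLike 𝕜] [NormedAddCommGroup X]
    [NormedSpace ℝ X] [NormedSpace 𝕜 X]
    (α : ℝ) (S : ℝ → X →L[𝕜] X) (t : ℝ) (x : X) : X :=
  fracConv (α - 1) (fun s => S s x) t

/-- The function `S(t)x + ∫₀ᵗ S(s)y ds + (P_α * f)(t)`, where
`(P_α * f)(t) = ∫₀ᵗ P_α(t - s) f(s) ds`. -/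
noncomputable def candidateSolution {𝕜 X : Type*} [RCLike 𝕜] [NormedAddCommGroup X]
    [NormedSpace ℝ X] [NormedSpace 𝕜 X]
    (α : ℝ) (S : ℝ → X →L[𝕜] X) (x y : X) (f : ℝ → X) (t : ℝ) : X :=
  S t x + (∫ s in (0 : ℝ)..t, S s y) + ∫ s in (0 : ℝ)..t, resolventP α S (t - s) (f s)

/-- `u` is a strong solution on `[0,r]` of `D_t^α u = A u + f`, `u(0) = x`, `u'(0) = y`.
The first two fields say that `u`, which is continuous by the third, is continuous into `D(A)`
with the graph norm. -/
structure IsStrongSolution {𝕜 X : Type*} [RCLike 𝕜] [NormedAddCommGroup X]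
    [NormedSpace ℝ X] [NormedSpace 𝕜 X]
    (α r : ℝ) (A : X →ₗ.[𝕜] X) (x y : X) (f u : ℝ → X) : Prop where
  mem_domain : ∀ t ∈ Icc 0 r, u t ∈ A.domain
  continuous_map : Continuous (fun t : Icc (0 : ℝ) r => A ⟨u t, mem_domain t t.2⟩)
  contDiffOn_one : ContDiffOn ℝ 1 u (Icc 0 r)
  contDiffOn_two :
    ContDiffOn ℝ 2 (fracConv (2 - α) (fun s => u s - x - s • y)) (Icc 0 r)
  initial : u 0 = x
  initial_deriv : derivWithin u (Icc 0 r) 0 = y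
  equation : ∀ t (ht : t ∈ Icc 0 r),
    caputoDeriv α r u t = A ⟨u t, mem_domain t ht⟩ + f t

/-- Maximal regularity on `C([0,r];X)`: for all `x, y ∈ D(A)` and every continuous `f` there is
a unique strong solution on `[0,r]`. -/
def HasMaximalRegularity {𝕜 X : Type*} [RCLike 𝕜] [NormedAddCommGroup X]
    [NormedSpace ℝ X] [NormedSpace 𝕜 X]
    (α r : ℝ) (A : X →ₗ.[𝕜] X) : Prop :=
  ∀ x ∈ A.domain, ∀ y ∈ A.domain, ∀ f : ℝ → X, ContinuousOn f (Icc 0 r) →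
    ∃ u : ℝ → X, IsStrongSolution α r A x y f u ∧
      ∀ v : ℝ → X, IsStrongSolution α r A x y f v → EqOn v u (Icc 0 r)

/-- A subdivision `a = d₀ < d₁ < ⋯ < dₙ = b` of `[a,b]`. -/
structure Subdivision (a b : ℝ) where
  n : ℕ
  d : Fin (n + 1) → ℝ
  strictMono : StrictMono d
  first : d 0 = a
  last : d (Fin.last n) = b

open scoped ENNReal in
/-- `SV_d[G]`, the supremum of `‖∑ᵢ (G(dᵢ) - G(dᵢ₋₁)) xᵢ‖` over all `xᵢ` with `‖xᵢ‖ ≤ 1`. -/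
noncomputable def semivariationOn {𝕜 X : Type*} [RCLike 𝕜] [NormedAddCommGroup X]
    [NormedSpace 𝕜 X] {a b : ℝ} (G : ℝ → X →L[𝕜] X) (p : Subdivision a b) : ℝ≥0∞ :=
  ⨆ (x : Fin p.n → X) (_ : ∀ i, ‖x i‖ ≤ 1),
    ‖∑ i : Fin p.n, (G (p.d i.succ) - G (p.d i.castSucc)) (x i)‖ₑ

open scoped ENNReal in
/-- `SV[G]`, the semivariation of `G` on `[a,b]`. -/
noncomputable def semivariation {𝕜 X : Type*} [RCLike 𝕜] [NormedAddCommGroup X]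
    [NormedSpace 𝕜 X] (a b : ℝ) (G : ℝ → X →L[𝕜] X) : ℝ≥0∞ :=
  ⨆ p : Subdivision a b, semivariationOn G p

/-- `G` is of bounded semivariation on `[a,b]`. -/
def HasBoundedSemivariation {𝕜 X : Type*} [RCLike 𝕜] [NormedAddCommGroup X]
    [NormedSpace 𝕜 X] (a b : ℝ) (G : ℝ → X →L[𝕜] X) : Prop :=
  semivariation a b G < ⊤

/-!
Integrating `(*)` with the kernel `g_α` gives `u(t) = x + t y + (g_α * (A u + f))(t)`. After
subtraction of the homogeneous solution `S(t)x + ∫₀ᵗ S(s)y ds` the initial values vanish and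
`u = g_α * k` with `k = A u + f`; since `A` is closed and `S = 1 + A (g_α * S)`, this holds if and
only if `S * f = 1 * k`. Hence `(*)` has a strong solution if and only if `S * f` is `C¹` on
`[0,r]`, and the solution is then unique and equal to the candidate.

It remains to see that `S * f` is `C¹` for every continuous `f` if and only if `S` has bounded
semivariation. If it has, the difference quotients of `S * f`, with step an integer fraction of `t`,
are averages of semivariation sums, so that `‖(S * f)'‖ ≤ (SV[S] + ‖S 0‖) ‖f‖` whenever `S * f` is
`C¹`; as this is the case on the dense set of `C¹` functions `f`, it is the case for all `f`.
Conversely, the closed graph theorem makes `f ↦ (S * f)'` bounded on `C([0,r];X)`, and its value at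
`r` on mollified step functions `f` of norm at most one approximates the semivariation sums.
-/

open MeasureTheory Filter Topology

section ParametricIntegral

variable {E : Type*} [NormedAddCommGroup E] [NormedSpace ℝ E]

lemma continuous_parametric_integral_smul {P : Type*} [TopologicalSpace P]
    [FirstCountableTopology P] {φ : ℝ → ℝ} (hφ : ∀ a b, IntervalIntegrable φ volume a b)
    {H : P → ℝ → E} (hH : Continuous (Function.uncurry H)) :
    Continuous fun p : P × ℝ => ∫ s in (0 : ℝ)..p.2, φ s • H p.1 s := by
  rw [continuous_iff_continuousAt]
  rintro ⟨x₀, b₀⟩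
  obtain ⟨a, ha⟩ := exists_lt (min 0 b₀)
  obtain ⟨b, hb⟩ := exists_gt (max 0 b₀)
  rw [lt_min_iff] at ha
  rw [max_lt_iff] at hb
  obtain ⟨C, hC⟩ := (isCompact_uIcc (a := a) (b := b)).exists_bound_of_continuousOn
    (f := H x₀) (by fun_prop : Continuous (H x₀)).continuousOn
  have hbound : ∀ᶠ x in 𝓝 x₀, ∀ s ∈ uIcc a b, ‖H x s‖ < C + 1 :=
    isCompact_uIcc.eventually_forall_of_forall_eventually fun s hs =>
      hH.norm.continuousAt.eventually_lt_const ((hC s hs).trans_lt (lt_add_one C))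
  refine intervalIntegral.continuousAt_parametric_primitive_of_dominated
    (F := fun x s => φ s • H x s) (fun s => |φ s| * (C + 1)) a b (fun x => ?_) ?_
    ((hφ a b).abs.mul_const _) (.of_forall fun s => ?_) ⟨ha.1, hb.1⟩ ⟨ha.2, hb.2⟩ (by simp)
  · exact (hφ a b).aestronglyMeasurable_restrict_uIoc.smul
      (by fun_prop : Continuous (H x)).aestronglyMeasurable
  · filter_upwards [hbound] with x hx
    filter_upwards [ae_restrict_mem measurableSet_uIoc] with s hs
    rw [norm_smul, Real.norm_eq_abs]
    gcongr
    exact (hx s (uIoc_subset_uIcc hs)).le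
  · exact (by fun_prop : Continuous fun x => φ s • H x s).continuousAt

lemma measurableSet_triangle (a b : ℝ) :
    MeasurableSet {p : ℝ × ℝ | a < p.2 ∧ p.2 ≤ p.1 ∧ p.1 ≤ b} :=
  (measurableSet_lt measurable_const measurable_snd).inter
    ((measurableSet_le measurable_snd measurable_fst).inter
      (measurableSet_le measurable_fst measurable_const))

lemma integral_integral_swap_triangle {F : ℝ → ℝ → E} {a b : ℝ} (hab : a ≤ b)
    (hF : IntegrableOn (Function.uncurry F) {p | a < p.2 ∧ p.2 ≤ p.1 ∧ p.1 ≤ b}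
      (volume.prod volume)) :
    ∫ s in a..b, ∫ τ in a..s, F s τ = ∫ τ in a..b, ∫ s in τ..b, F s τ := by
  set Δ : Set (ℝ × ℝ) := {p | a < p.2 ∧ p.2 ≤ p.1 ∧ p.1 ≤ b}
  set G : ℝ → ℝ → E := fun s τ => Δ.indicator (Function.uncurry F) (s, τ)
  have hleft (s : ℝ) : ∫ τ, G s τ = (Ioc a b).indicator (fun s => ∫ τ in a..s, F s τ) s := by
    by_cases hs : s ∈ Ioc a b
    · rw [indicator_of_mem hs, intervalIntegral.integral_of_le hs.1.le,
        ← integral_indicator measurableSet_Ioc]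
      refine integral_congr_ae (.of_forall fun τ => ?_)
      simp only [G, Δ, indicator, mem_ofPred_eq, mem_Ioc, hs.2, and_true, Function.uncurry]
    · rw [indicator_of_notMem hs]
      refine integral_eq_zero_of_ae (.of_forall fun τ => indicator_of_notMem ?_ _)
      exact fun h => hs ⟨h.1.trans_le h.2.1, h.2.2⟩
  have hright (τ : ℝ) : ∫ s, G s τ = (Ioc a b).indicator (fun τ => ∫ s in τ..b, F s τ) τ := by
    by_cases hτ : τ ∈ Ioc a b
    · rw [indicator_of_mem hτ, intervalIntegral.integral_of_le hτ.2,
        ← integral_Icc_eq_integral_Ioc, ← integral_indicator measurableSet_Icc]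
      refine integral_congr_ae (.of_forall fun s => ?_)
      simp only [G, Δ, indicator, mem_ofPred_eq, mem_Icc, hτ.1, true_and, Function.uncurry]
    · rw [indicator_of_notMem hτ]
      refine integral_eq_zero_of_ae (.of_forall fun s => indicator_of_notMem ?_ _)
      exact fun h => hτ ⟨h.1, h.2.1.trans h.2.2⟩
  have hswap : ∫ s, ∫ τ, G s τ = ∫ τ, ∫ s, G s τ :=
    integral_integral_swap ((integrable_indicator_iff (measurableSet_triangle a b)).2 hF)
  rwa [integral_congr_ae (.of_forall hleft), integral_congr_ae (.of_forall hright),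
    integral_indicator measurableSet_Ioc, integral_indicator measurableSet_Ioc,
    ← intervalIntegral.integral_of_le hab, ← intervalIntegral.integral_of_le hab] at hswap

lemma integrableOn_triangle_mul_smul {φ ψ : ℝ → ℝ}
    (hφ : ∀ a b, IntervalIntegrable φ volume a b) (hψ : ∀ a b, IntervalIntegrable ψ volume a b)
    {W : ℝ → ℝ → E} (hW : Continuous (Function.uncurry W)) (t : ℝ) :
    IntegrableOn (fun p : ℝ × ℝ => (φ (t - p.1) * ψ (p.1 - p.2)) • W p.1 p.2)
      {p | 0 < p.2 ∧ p.2 ≤ p.1 ∧ p.1 ≤ t} (volume.prod volume) := by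
  set k : ℝ → ℝ := (Ioc 0 t).indicator fun s => φ (t - s) with hk
  set l : ℝ → ℝ := (Icc (-t) 0).indicator fun x => ψ (-x) with hl
  have hk_int : Integrable k := by
    rw [hk, integrable_indicator_iff measurableSet_Ioc]
    have h := intervalIntegrable_iff.1 ((hφ (t - 0) (t - t)).comp_sub_left t)
    simp only [sub_sub_cancel] at h
    exact h.mono_set Ioc_subset_uIoc
  have hl_int : Integrable l := by
    rw [hl, integrable_indicator_iff measurableSet_Icc, integrableOn_Icc_iff_integrableOn_Ioc]
    have h := intervalIntegrable_iff.1 ((hψ t 0).comp_sub_left 0)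
    simp only [zero_sub, neg_zero] at h
    exact h.mono_set Ioc_subset_uIoc
  -- The product of the two truncated kernels is the integrand of a convolution of `L¹` functions.
  have hkl : Integrable (fun p : ℝ × ℝ => k p.1 * l (p.2 - p.1)) (volume.prod volume) :=
    (hk_int.convolution_integrand (ContinuousLinearMap.mul ℝ ℝ) hl_int).swap
  have hsquare : IntegrableOn (fun p : ℝ × ℝ => (k p.1 * l (p.2 - p.1)) • W p.1 p.2)
      (Icc 0 t ×ˢ Icc 0 t) (volume.prod volume) :=
    hkl.integrableOn.smul_continuousOn hW.continuousOn (isCompact_Icc.prod isCompact_Icc)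
  refine (hsquare.mono_set fun p hp => ?_).congr_fun (fun p hp => ?_) ?_
  · exact ⟨⟨(hp.1.trans_le hp.2.1).le, hp.2.2⟩, hp.1.le, hp.2.1.trans hp.2.2⟩
  · have hp₁ : p.1 ∈ Ioc 0 t := ⟨hp.1.trans_le hp.2.1, hp.2.2⟩
    have hp₂ : p.2 - p.1 ∈ Icc (-t) 0 := ⟨by linarith [hp.1, hp.2.2], by linarith [hp.2.1]⟩
    simp only [hk, hl, indicator_of_mem hp₁, indicator_of_mem hp₂, neg_sub]
  · exact measurableSet_triangle 0 t

end ParametricIntegral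

section KernelConv

variable {𝕜 X : Type*} [RCLike 𝕜] [NormedAddCommGroup X] [NormedSpace ℝ X] [NormedSpace 𝕜 X]

/-- The convolution `((φ T) * f)(t) = ∫₀ᵗ φ(t - s) T(t - s) f(s) ds` of a scalar kernel times an
operator family with a function. It unifies `fracConv`, where `T` is constantly the identity, and
`opConv`, where `φ = 1`. -/
noncomputable def kernelConv (φ : ℝ → ℝ) (T : ℝ → X →L[𝕜] X) (f : ℝ → X) (t : ℝ) : X :=
  ∫ s in (0 : ℝ)..t, φ (t - s) • T (t - s) (f s)

variable {φ ψ : ℝ → ℝ} {T U : ℝ → X →L[𝕜] X} {f g : ℝ → X} {t : ℝ}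

lemma kernelConv_congr (φ : ℝ → ℝ) (ht : 0 ≤ t) (hTU : EqOn T U (Icc 0 t))
    (hfg : EqOn f g (Icc 0 t)) : kernelConv φ T f t = kernelConv φ U g t := by
  refine intervalIntegral.integral_congr fun s hs => ?_
  rw [uIcc_of_le ht] at hs
  simp only [hfg hs, hTU ⟨sub_nonneg.2 hs.2, sub_le_self t hs.1⟩]

lemma kernelConv_eq_integral_flip (φ : ℝ → ℝ) (T : ℝ → X →L[𝕜] X) (f : ℝ → X) (t : ℝ) :
    kernelConv φ T f t = ∫ s in (0 : ℝ)..t, φ s • T s (f (t - s)) := by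
  simpa [kernelConv] using intervalIntegral.integral_comp_sub_left (a := 0) (b := t)
    (fun s => φ s • T s (f (t - s))) t

lemma kernelConv_const_smul [IsScalarTower ℝ 𝕜 X] (φ : ℝ → ℝ) (T : ℝ → X →L[𝕜] X) (c : 𝕜)
    (f : ℝ → X) (t : ℝ) :
    kernelConv φ T (fun s => c • f s) t = c • kernelConv φ T f t := by
  simp only [kernelConv, map_smul, smul_comm _ c, intervalIntegral.integral_smul]

lemma continuous_uncurry_kernelConv {P : Type*} [TopologicalSpace P] [FirstCountableTopology P]
    (hφ : ∀ a b, IntervalIntegrable φ volume a b) (hT : Continuous fun p : ℝ × X => T p.1 p.2)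
    {F : P → ℝ → X} (hF : Continuous (Function.uncurry F)) :
    Continuous fun p : P × ℝ => kernelConv φ T (F p.1) p.2 := by
  simp only [kernelConv_eq_integral_flip]
  have hH : Continuous (Function.uncurry fun (p : P × ℝ) s => T s (F p.1 (p.2 - s))) :=
    hT.comp (by fun_prop : Continuous fun q : (P × ℝ) × ℝ => (q.2, F q.1.1 (q.1.2 - q.2)))
  exact (continuous_parametric_integral_smul hφ hH).comp
    (by fun_prop : Continuous fun p : P × ℝ => (p, p.2))

lemma continuous_kernelConv (hφ : ∀ a b, IntervalIntegrable φ volume a b)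
    (hT : Continuous fun p : ℝ × X => T p.1 p.2) (hf : Continuous f) :
    Continuous (kernelConv φ T f) :=
  (continuous_uncurry_kernelConv (P := Unit) hφ hT (F := fun _ => f) (by fun_prop)).comp
    (Continuous.prodMk_right ())

lemma intervalIntegrable_kernelConv (hφ : ∀ a b, IntervalIntegrable φ volume a b)
    (hT : Continuous fun p : ℝ × X => T p.1 p.2) (hf : Continuous f) (t a b : ℝ) :
    IntervalIntegrable (fun s => φ (t - s) • T (t - s) (f s)) volume a b := by
  have hφt := (hφ (t - a) (t - b)).comp_sub_left t
  simp only [sub_sub_cancel] at hφt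
  exact hφt.smul_continuousOn
    (hT.comp (by fun_prop : Continuous fun s => (t - s, f s))).continuousOn

lemma kernelConv_add (hφ : ∀ a b, IntervalIntegrable φ volume a b)
    (hT : Continuous fun p : ℝ × X => T p.1 p.2) (hf : Continuous f) (hg : Continuous g) (t : ℝ) :
    kernelConv φ T (fun s => f s + g s) t = kernelConv φ T f t + kernelConv φ T g t := by
  simp only [kernelConv, map_add, smul_add]
  exact intervalIntegral.integral_add (intervalIntegrable_kernelConv hφ hT hf _ _ _)
    (intervalIntegrable_kernelConv hφ hT hg _ _ _)

lemma kernelConv_sub (hφ : ∀ a b, IntervalIntegrable φ volume a b)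
    (hT : Continuous fun p : ℝ × X => T p.1 p.2) (hf : Continuous f) (hg : Continuous g) (t : ℝ) :
    kernelConv φ T (fun s => f s - g s) t = kernelConv φ T f t - kernelConv φ T g t := by
  simp only [kernelConv, map_sub, smul_sub]
  exact intervalIntegral.integral_sub (intervalIntegrable_kernelConv hφ hT hf _ _ _)
    (intervalIntegrable_kernelConv hφ hT hg _ _ _)

lemma kernelConv_kernelConv [IsScalarTower ℝ 𝕜 X] [CompleteSpace X]
    (hφ : ∀ a b, IntervalIntegrable φ volume a b) (hT : Continuous fun p : ℝ × X => T p.1 p.2)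
    (hψ : ∀ a b, IntervalIntegrable ψ volume a b) (hU : Continuous fun p : ℝ × X => U p.1 p.2)
    (hf : Continuous f) (ht : 0 ≤ t) :
    kernelConv φ T (kernelConv ψ U f) t = ∫ τ in (0 : ℝ)..t, ∫ σ in (0 : ℝ)..(t - τ),
      (φ (t - τ - σ) * ψ σ) • T (t - τ - σ) (U σ (f τ)) := by
  have hW : Continuous (Function.uncurry fun s τ => T (t - s) (U (s - τ) (f τ))) :=
    hT.comp ((by fun_prop : Continuous fun p : ℝ × ℝ => t - p.1).prodMk
      (hU.comp (by fun_prop : Continuous fun p : ℝ × ℝ => (p.1 - p.2, f p.2))))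
  calc kernelConv φ T (kernelConv ψ U f) t
      = ∫ s in (0 : ℝ)..t, ∫ τ in (0 : ℝ)..s,
          (φ (t - s) * ψ (s - τ)) • T (t - s) (U (s - τ) (f τ)) := by
        refine intervalIntegral.integral_congr fun s _ => ?_
        simp only [kernelConv]
        rw [← ContinuousLinearMap.intervalIntegral_comp_comm _
          (intervalIntegrable_kernelConv hψ hU hf _ _ _), ← intervalIntegral.integral_smul]
        simp only [ContinuousLinearMap.map_smul_of_tower, mul_smul]
    _ = ∫ τ in (0 : ℝ)..t, ∫ s in τ..t,
          (φ (t - s) * ψ (s - τ)) • T (t - s) (U (s - τ) (f τ)) :=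
        integral_integral_swap_triangle ht (integrableOn_triangle_mul_smul hφ hψ hW t)
    _ = _ := by
        refine intervalIntegral.integral_congr fun τ _ => ?_
        have hshift := intervalIntegral.integral_comp_add_left (a := 0) (b := t - τ)
          (fun s => (φ (t - s) * ψ (s - τ)) • T (t - s) (U (s - τ) (f τ))) τ
        simpa only [add_sub_cancel_left, add_zero, add_sub_cancel, ← sub_sub] using hshift.symm

lemma kernelConv_comm [IsScalarTower ℝ 𝕜 X] [CompleteSpace X]
    (hφ : ∀ a b, IntervalIntegrable φ volume a b) (hT : Continuous fun p : ℝ × X => T p.1 p.2)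
    (hψ : ∀ a b, IntervalIntegrable ψ volume a b) (hU : Continuous fun p : ℝ × X => U p.1 p.2)
    (hTU : ∀ a b, Commute (T a) (U b)) (hf : Continuous f) (ht : 0 ≤ t) :
    kernelConv φ T (kernelConv ψ U f) t = kernelConv ψ U (kernelConv φ T f) t := by
  rw [kernelConv_kernelConv hφ hT hψ hU hf ht, kernelConv_kernelConv hψ hU hφ hT hf ht]
  refine intervalIntegral.integral_congr fun τ _ => ?_
  have hflip := intervalIntegral.integral_comp_sub_left (a := 0) (b := t - τ)
    (fun σ => (ψ (t - τ - σ) * φ σ) • U (t - τ - σ) (T σ (f τ))) (t - τ)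
  simp only [sub_sub_cancel, sub_self, sub_zero] at hflip
  rw [← hflip]
  refine intervalIntegral.integral_congr fun σ _ => ?_
  simp only [mul_comm (φ _)]
  exact congrArg _ (DFunLike.congr_fun (hTU (t - τ - σ) σ).eq (f τ))

end KernelConv

section OpConv

variable {𝕜 X : Type*} [RCLike 𝕜] [NormedAddCommGroup X] [NormedSpace ℝ X] [NormedSpace 𝕜 X]
  {S T : ℝ → X →L[𝕜] X} {f g : ℝ → X} {t : ℝ}

/-- The convolution `(S * f)(t) = ∫₀ᵗ S(t - s) f(s) ds` of an operator family with a function. -/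
noncomputable def opConv (S : ℝ → X →L[𝕜] X) : (ℝ → X) → ℝ → X :=
  kernelConv (fun _ => 1) S

lemma opConv_apply (S : ℝ → X →L[𝕜] X) (f : ℝ → X) (t : ℝ) :
    opConv S f t = ∫ s in (0 : ℝ)..t, S (t - s) (f s) := by
  simp only [opConv, kernelConv, one_smul]

lemma opConv_apply_flip (S : ℝ → X →L[𝕜] X) (f : ℝ → X) (t : ℝ) :
    opConv S f t = ∫ s in (0 : ℝ)..t, S s (f (t - s)) := by
  simp only [opConv, kernelConv_eq_integral_flip, one_smul]

lemma opConv_apply_zero (S : ℝ → X →L[𝕜] X) (f : ℝ → X) : opConv S f 0 = 0 := by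
  rw [opConv_apply, intervalIntegral.integral_same]

lemma opConv_congr (ht : 0 ≤ t) (hST : EqOn S T (Icc 0 t)) (hfg : EqOn f g (Icc 0 t)) :
    opConv S f t = opConv T g t :=
  kernelConv_congr _ ht hST hfg

lemma continuous_opConv (hS : Continuous fun p : ℝ × X => S p.1 p.2) (hf : Continuous f) :
    Continuous (opConv S f) :=
  continuous_kernelConv (fun _ _ => intervalIntegrable_const) hS hf

lemma opConv_add (hS : Continuous fun p : ℝ × X => S p.1 p.2) (hf : Continuous f)
    (hg : Continuous g) (t : ℝ) :
    opConv S (fun s => f s + g s) t = opConv S f t + opConv S g t :=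
  kernelConv_add (fun _ _ => intervalIntegrable_const) hS hf hg t

end OpConv

lemma exists_continuous_eqOn_Icc {Y : Type*} [TopologicalSpace Y] {a b : ℝ} (hab : a ≤ b)
    {f : ℝ → Y} (hf : ContinuousOn f (Icc a b)) :
    ∃ g : ℝ → Y, Continuous g ∧ EqOn f g (Icc a b) :=
  ⟨_, hf.domRestrict.Icc_extend', fun _ ht =>
    (IccExtend_of_mem hab ((Icc a b).domRestrict f) ht).symm⟩

section FracConv

variable {X : Type*} [NormedAddCommGroup X] [NormedSpace ℝ X] {β γ t : ℝ} {f g : ℝ → X}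

lemma intervalIntegrable_fracKernel (hβ : 0 < β) (a b : ℝ) :
    IntervalIntegrable (fracKernel β) volume a b :=
  (intervalIntegral.intervalIntegrable_rpow' (by linarith)).div_const _

lemma integral_rpow_mul_sub_rpow {a b u : ℝ} (ha : 0 < a) (hb : 0 < b) (hu : 0 < u) :
    ∫ s in (0 : ℝ)..u, s ^ (a - 1) * (u - s) ^ (b - 1) =
      u ^ (a + b - 1) * ProbabilityTheory.beta a b := by
  have hscaled := congrArg Complex.re (Complex.betaIntegral_scaled (a : ℂ) (b : ℂ) hu)
  have hreal : ∫ s in (0 : ℝ)..u, (s : ℂ) ^ ((a : ℂ) - 1) * ((u : ℂ) - s) ^ ((b : ℂ) - 1) =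
      ((∫ s in (0 : ℝ)..u, s ^ (a - 1) * (u - s) ^ (b - 1) : ℝ) : ℂ) := by
    rw [← intervalIntegral.integral_ofReal]
    refine intervalIntegral.integral_congr fun s hs => ?_
    rw [uIcc_of_le hu.le] at hs
    push_cast [Complex.ofReal_cpow hs.1, Complex.ofReal_cpow (sub_nonneg.2 hs.2)]
    rfl
  have hpow : (u : ℂ) ^ ((a : ℂ) + b - 1) = ((u ^ (a + b - 1) : ℝ) : ℂ) := by
    push_cast [Complex.ofReal_cpow hu.le]
    rfl
  rwa [hreal, hpow, Complex.ofReal_re, Complex.re_ofReal_mul,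
    ← ProbabilityTheory.beta_eq_betaIntegralReal a b ha hb] at hscaled

lemma integral_fracKernel_mul_fracKernel (hβ : 0 < β) (hγ : 0 < γ) {u : ℝ} (hu : 0 < u) :
    ∫ s in (0 : ℝ)..u, fracKernel β (u - s) * fracKernel γ s = fracKernel (β + γ) u := by
  have hβ' := (Real.Gamma_pos_of_pos hβ).ne'
  have hγ' := (Real.Gamma_pos_of_pos hγ).ne'
  calc ∫ s in (0 : ℝ)..u, fracKernel β (u - s) * fracKernel γ s
      = ∫ s in (0 : ℝ)..u, (Real.Gamma β * Real.Gamma γ)⁻¹ *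
          (s ^ (γ - 1) * (u - s) ^ (β - 1)) := by
        refine intervalIntegral.integral_congr fun s _ => ?_
        simp only [fracKernel]
        field_simp
    _ = fracKernel (β + γ) u := by
        rw [intervalIntegral.integral_const_mul, integral_rpow_mul_sub_rpow hγ hβ hu,
          ProbabilityTheory.beta, fracKernel, add_comm γ β]
        field_simp

lemma fracConv_one (f : ℝ → X) (t : ℝ) : fracConv 1 f t = ∫ s in (0 : ℝ)..t, f s := by
  simp [fracConv, fracKernel]

lemma fracConv_apply_zero (β : ℝ) (f : ℝ → X) : fracConv β f 0 = 0 := by simp [fracConv]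

lemma fracConv_eq_kernelConv (𝕜 : Type*) [RCLike 𝕜] [NormedSpace 𝕜 X] (β : ℝ) :
    fracConv β = kernelConv (fracKernel β) (fun _ => ContinuousLinearMap.id 𝕜 X) :=
  rfl

lemma fracConv_congr (β : ℝ) (ht : 0 ≤ t) (h : EqOn f g (Icc 0 t)) :
    fracConv β f t = fracConv β g t :=
  kernelConv_congr (T := fun _ => .id ℝ X) (fracKernel β) ht (eqOn_refl _ _) h

lemma continuous_uncurry_fracConv {P : Type*} [TopologicalSpace P] [FirstCountableTopology P]
    (hβ : 0 < β) {F : P → ℝ → X} (hF : Continuous (Function.uncurry F)) :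
    Continuous fun p : P × ℝ => fracConv β (F p.1) p.2 :=
  continuous_uncurry_kernelConv (T := fun _ => .id ℝ X) (intervalIntegrable_fracKernel hβ)
    continuous_snd hF

lemma continuous_fracConv (hβ : 0 < β) (hf : Continuous f) : Continuous (fracConv β f) :=
  continuous_kernelConv (T := fun _ => .id ℝ X) (intervalIntegrable_fracKernel hβ)
    continuous_snd hf

lemma intervalIntegrable_fracKernel_smul (hβ : 0 < β) (hf : Continuous f) (t a b : ℝ) :
    IntervalIntegrable (fun s => fracKernel β (t - s) • f s) volume a b :=
  intervalIntegrable_kernelConv (T := fun _ => .id ℝ X) (intervalIntegrable_fracKernel hβ)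
    continuous_snd hf t a b

lemma fracConv_add (hβ : 0 < β) (hf : Continuous f) (hg : Continuous g) (t : ℝ) :
    fracConv β (fun s => f s + g s) t = fracConv β f t + fracConv β g t :=
  kernelConv_add (T := fun _ => .id ℝ X) (intervalIntegrable_fracKernel hβ) continuous_snd hf hg t

lemma fracConv_sub (hβ : 0 < β) (hf : Continuous f) (hg : Continuous g) (t : ℝ) :
    fracConv β (fun s => f s - g s) t = fracConv β f t - fracConv β g t :=
  kernelConv_sub (T := fun _ => .id ℝ X) (intervalIntegrable_fracKernel hβ) continuous_snd hf hg t

variable [CompleteSpace X]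

lemma fracConv_fracConv (hβ : 0 < β) (hγ : 0 < γ) (hf : Continuous f) (ht : 0 ≤ t) :
    fracConv β (fracConv γ f) t = fracConv (β + γ) f t := by
  simp only [fracConv_eq_kernelConv ℝ]
  rw [kernelConv_kernelConv (intervalIntegrable_fracKernel hβ) continuous_snd
    (intervalIntegrable_fracKernel hγ) continuous_snd hf ht, kernelConv]
  refine intervalIntegral.integral_congr_ae ?_
  filter_upwards [compl_mem_ae_iff.2 (measure_singleton t)] with τ hτ hτt
  rw [uIoc_of_le ht] at hτt
  simp only [ContinuousLinearMap.id_apply]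
  rw [intervalIntegral.integral_smul_const, integral_fracKernel_mul_fracKernel hβ hγ
    (sub_pos.2 (lt_of_le_of_ne hτt.2 hτ))]

lemma fracConv_one_fracConv_sub_one (hβ : 1 < β) (hf : Continuous f) (ht : 0 ≤ t) :
    fracConv 1 (fracConv (β - 1) f) t = fracConv β f t := by
  rw [fracConv_fracConv one_pos (sub_pos.2 hβ) hf ht, add_sub_cancel]

lemma hasDerivAt_fracConv_one (hf : Continuous f) (t : ℝ) :
    HasDerivAt (fracConv 1 f) (f t) t := by
  rw [funext (fracConv_one f)]
  exact intervalIntegral.integral_hasDerivAt_right (hf.intervalIntegrable _ _)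
    hf.aestronglyMeasurable.stronglyMeasurableAtFilter hf.continuousAt

lemma derivWithin_fracConv_one {r : ℝ} (hr : 0 < r) (hf : Continuous f) (ht : t ∈ Icc 0 r) :
    derivWithin (fracConv 1 f) (Icc 0 r) t = f t :=
  (hasDerivAt_fracConv_one hf t).hasDerivWithinAt.derivWithin (uniqueDiffOn_Icc hr t ht)

lemma eqOn_of_eqOn_fracConv_one {r : ℝ} (hr : 0 < r) (hf : Continuous f) (hg : Continuous g)
    (h : EqOn (fracConv 1 f) (fracConv 1 g) (Icc 0 r)) : EqOn f g (Icc 0 r) := fun t ht => by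
  rw [← derivWithin_fracConv_one hr hf ht, ← derivWithin_fracConv_one hr hg ht]
  exact derivWithin_congr h (h ht)

lemma contDiff_one_fracConv_one (hf : Continuous f) : ContDiff ℝ 1 (fracConv 1 f) := by
  rw [contDiff_one_iff_deriv, funext fun t => (hasDerivAt_fracConv_one hf t).deriv]
  exact ⟨fun t => (hasDerivAt_fracConv_one hf t).differentiableAt, hf⟩

lemma contDiff_two_fracConv_one_fracConv_one (hf : Continuous f) :
    ContDiff ℝ 2 (fracConv 1 (fracConv 1 f)) := by
  have hd := hasDerivAt_fracConv_one (continuous_fracConv one_pos hf)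
  rw [show (2 : WithTop ℕ∞) = 1 + 1 from rfl, contDiff_succ_iff_deriv, funext fun t => (hd t).deriv]
  exact ⟨fun t => (hd t).differentiableAt, by simp, contDiff_one_fracConv_one hf⟩

lemma iteratedDerivWithin_two_fracConv_one_fracConv_one {r : ℝ} (hr : 0 < r) (hf : Continuous f)
    (ht : t ∈ Icc 0 r) :
    iteratedDerivWithin 2 (fracConv 1 (fracConv 1 f)) (Icc 0 r) t = f t := by
  have hd : EqOn (derivWithin (fracConv 1 (fracConv 1 f)) (Icc 0 r)) (fracConv 1 f) (Icc 0 r) :=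
    fun s hs => derivWithin_fracConv_one hr (continuous_fracConv one_pos hf) hs
  rw [iteratedDerivWithin_succ, iteratedDerivWithin_one, derivWithin_congr hd (hd ht),
    derivWithin_fracConv_one hr hf ht]

lemma exists_eqOn_add_fracConv_one {r : ℝ} (hr : 0 < r) {u : ℝ → X}
    (hu : ContDiffOn ℝ 1 u (Icc 0 r)) : ∃ v : ℝ → X, Continuous v ∧
      EqOn (derivWithin u (Icc 0 r)) v (Icc 0 r) ∧
      EqOn u (fun t => u 0 + fracConv 1 v t) (Icc 0 r) := by
  have hcont : ContinuousOn (derivWithin u (Icc 0 r)) (Icc 0 r) :=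
    ((contDiffOn_one_iff_derivWithin (uniqueDiffOn_Icc hr)).1 hu).2
  obtain ⟨v, hv, huv⟩ := exists_continuous_eqOn_Icc hr.le hcont
  refine ⟨v, hv, huv, fun t ht => ?_⟩
  have hsub : Icc 0 t ⊆ Icc 0 r := Icc_subset_Icc_right ht.2
  have hderiv (s : ℝ) (hs : s ∈ Ioo 0 t) : HasDerivAt u (v s) s := by
    have hs' : s ∈ Icc 0 r := hsub (Ioo_subset_Icc_self hs)
    rw [← huv hs']
    exact (hu.differentiableOn one_ne_zero s hs').hasDerivWithinAt.hasDerivAt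
      (Icc_mem_nhds hs.1 (hs.2.trans_le ht.2))
  simp only [fracConv_one]
  rw [intervalIntegral.integral_eq_sub_of_hasDerivAt_of_le ht.1 (hu.continuousOn.mono hsub) hderiv
    (hv.intervalIntegrable _ _), add_sub_cancel]

lemma contDiffOn_one_iff_exists_eqOn_fracConv_one {r : ℝ} (hr : 0 < r) {u : ℝ → X}
    (hu : u 0 = 0) : ContDiffOn ℝ 1 u (Icc 0 r) ↔
      ∃ v : ℝ → X, Continuous v ∧ EqOn u (fracConv 1 v) (Icc 0 r) := by
  refine ⟨fun h => ?_, fun ⟨v, hv, huv⟩ => (contDiff_one_fracConv_one hv).contDiffOn.congr huv⟩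
  obtain ⟨v, hv, -, huv⟩ := exists_eqOn_add_fracConv_one hr h
  exact ⟨v, hv, fun t ht => (huv ht).trans (by simp only [hu, zero_add])⟩

end FracConv

section ClosedSubspace

variable {E F : Type*} [NormedAddCommGroup E] [NormedSpace ℝ E] [CompleteSpace E]
  [NormedAddCommGroup F] [NormedSpace ℝ F] [CompleteSpace F]

lemma intervalIntegral_mem_of_isClosed {K : Submodule ℝ E} (hK : IsClosed (K : Set E))
    {f : ℝ → E} {a b : ℝ} (hab : a ≤ b) (hf : ∀ s ∈ Icc a b, f s ∈ K) :
    ∫ s in a..b, f s ∈ K := by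
  by_cases hint : IntervalIntegrable f volume a b
  · rw [← Submodule.Quotient.mk_eq_zero]
    have hzero : ∫ s in a..b, K.mkQL (f s) = 0 := by
      refine (intervalIntegral.integral_congr fun s hs => ?_).trans intervalIntegral.integral_zero
      rw [uIcc_of_le hab] at hs
      exact (Submodule.Quotient.mk_eq_zero K).2 (hf s hs)
    rwa [K.mkQL.intervalIntegral_comp_comm hint] at hzero
  · rw [intervalIntegral.integral_undef hint]
    exact K.zero_mem

lemma prodMk_intervalIntegral_mem_of_isClosed {K : Submodule ℝ (E × F)}
    (hK : IsClosed (K : Set (E × F))) {f : ℝ → E} {g : ℝ → F} {a b : ℝ} (hab : a ≤ b)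
    (hf : IntervalIntegrable f volume a b) (hg : IntervalIntegrable g volume a b)
    (hfg : ∀ s ∈ Icc a b, (f s, g s) ∈ K) : (∫ s in a..b, f s, ∫ s in a..b, g s) ∈ K := by
  have hpair := intervalIntegral_mem_of_isClosed hK hab hfg
  simp only [intervalIntegral.integral_of_le hab] at hpair ⊢
  rwa [integral_pair hf.1 hg.1] at hpair

lemma prodMk_fracConv_mem_of_isClosed {K : Submodule ℝ (E × F)} (hK : IsClosed (K : Set (E × F)))
    {β : ℝ} (hβ : 0 < β) {f : ℝ → E} {g : ℝ → F} (hf : Continuous f) (hg : Continuous g) {t : ℝ}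
    (ht : 0 ≤ t) (hfg : ∀ s ∈ Icc 0 t, (f s, g s) ∈ K) :
    (fracConv β f t, fracConv β g t) ∈ K :=
  prodMk_intervalIntegral_mem_of_isClosed hK ht (intervalIntegrable_fracKernel_smul hβ hf _ _ _)
    (intervalIntegrable_fracKernel_smul hβ hg _ _ _) fun s hs => K.smul_mem _ (hfg s hs)

lemma prodMk_mem_of_prodMk_fracConv_one_mem {K : Submodule ℝ (E × F)}
    (hK : IsClosed (K : Set (E × F))) {r : ℝ} (hr : 0 < r) {f : ℝ → E} {g : ℝ → F}
    (hf : Continuous f) (hg : Continuous g)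
    (hfg : ∀ t ∈ Icc 0 r, (fracConv 1 f t, fracConv 1 g t) ∈ K) :
    ∀ t ∈ Icc 0 r, (f t, g t) ∈ K := by
  intro t ht
  have hderiv := ((hasDerivAt_fracConv_one hf t).prodMk
    (hasDerivAt_fracConv_one hg t)).hasDerivWithinAt.derivWithin (uniqueDiffOn_Icc hr t ht)
  have hmem := range_derivWithin_subset_closure_span_image (𝕜 := ℝ) (s := Icc 0 r) (t := Icc 0 r)
    (fun t => (fracConv 1 f t, fracConv 1 g t)) (by rw [inter_self]; exact subset_closure)
    (mem_range_self t)
  rw [hderiv] at hmem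
  exact closure_minimal (Submodule.span_le.2 (image_subset_iff.2 hfg)) hK hmem

end ClosedSubspace

section OpConvFracConv

variable {𝕜 X : Type*} [RCLike 𝕜] [NormedAddCommGroup X] [NormedSpace ℝ X] [NormedSpace 𝕜 X]
  [IsScalarTower ℝ 𝕜 X] [CompleteSpace X] {S : ℝ → X →L[𝕜] X} {f : ℝ → X} {β t : ℝ}

lemma opConv_fracConv (hS : Continuous fun p : ℝ × X => S p.1 p.2) (hβ : 0 < β)
    (hf : Continuous f) (ht : 0 ≤ t) :
    opConv S (fracConv β f) t = fracConv β (opConv S f) t := by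
  simp only [fracConv_eq_kernelConv 𝕜]
  exact kernelConv_comm (fun _ _ => intervalIntegrable_const) hS
    (intervalIntegrable_fracKernel hβ) continuous_snd (fun _ _ => Commute.one_right _) hf ht

lemma fracConv_opConv_eq_integral (hS : Continuous fun p : ℝ × X => S p.1 p.2) (hβ : 0 < β)
    (hf : Continuous f) (ht : 0 ≤ t) : fracConv β (opConv S f) t =
      ∫ τ in (0 : ℝ)..t, fracConv β (fun s => S s (f τ)) (t - τ) := by
  simp only [fracConv_eq_kernelConv 𝕜, opConv]
  rw [kernelConv_kernelConv (intervalIntegrable_fracKernel hβ) continuous_snd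
    (fun _ _ => intervalIntegrable_const) hS hf ht]
  simp only [mul_one, kernelConv]

lemma opConv_const_add_fracConv_one (hS : Continuous fun p : ℝ × X => S p.1 p.2) (z : X)
    (hf : Continuous f) (ht : 0 ≤ t) :
    opConv S (fun s => z + fracConv 1 f s) t = fracConv 1 (fun s => S s z + opConv S f s) t := by
  rw [opConv_add hS continuous_const (continuous_fracConv one_pos hf),
    opConv_fracConv hS one_pos hf ht, fracConv_add one_pos (f := fun s => S s z)
      (hS.comp (Continuous.prodMk_left z)) (continuous_opConv hS hf), opConv_apply_flip,
    fracConv_one fun s => S s z]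

end OpConvFracConv

section Graph

variable {𝕜 X : Type*} [RCLike 𝕜] [NormedAddCommGroup X] [NormedSpace ℝ X] [NormedSpace 𝕜 X]
  [IsScalarTower ℝ 𝕜 X] [CompleteSpace X]

lemma fracConv_mem_graph {A : X →ₗ.[𝕜] X} (hA : A.IsClosed) {β t : ℝ} (hβ : 0 < β)
    {f g : ℝ → X} (hf : Continuous f) (hg : Continuous g) (ht : 0 ≤ t)
    (hfg : ∀ s ∈ Icc 0 t, (f s, g s) ∈ A.graph) : (fracConv β f t, fracConv β g t) ∈ A.graph :=
  prodMk_fracConv_mem_of_isClosed (K := A.graph.restrictScalars ℝ) hA hβ hf hg ht hfg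

end Graph

namespace IsResolventFamily

variable {𝕜 X : Type*} [RCLike 𝕜] [NormedAddCommGroup X] [NormedSpace ℝ X] [NormedSpace 𝕜 X]
  {α r t : ℝ} {A : X →ₗ.[𝕜] X} {S : ℝ → X →L[𝕜] X} {f g m : ℝ → X} {x y : X}

lemma apply_mem_graph (hS : IsResolventFamily α A S) (ht : 0 ≤ t) (hxy : (x, y) ∈ A.graph) :
    (S t x, S t y) ∈ A.graph := by
  obtain ⟨x, rfl, rfl⟩ := A.mem_graph_iff.1 hxy
  obtain ⟨h, hA⟩ := hS.commutes t ht x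
  exact A.mem_graph_iff.2 ⟨⟨S t x, h⟩, rfl, hA⟩

variable [IsScalarTower ℝ 𝕜 X] [CompleteSpace X]

lemma fracConv_apply_mem_graph (hS : IsResolventFamily α A S)
    (hc : Continuous fun p : ℝ × X => S p.1 p.2) (hα : 0 < α) (ht : 0 ≤ t) (z : X) :
    (fracConv α (fun s => S s z) t, S t z - z) ∈ A.graph := by
  have hclosed : IsClosed {z : X | (fracConv α (fun s => S s z) t, S t z - z) ∈ A.graph} := by
    refine hS.isClosed.preimage (Continuous.prodMk ?_ (by fun_prop))
    exact (continuous_uncurry_fracConv hα (F := fun z s => S s z) (hc.comp continuous_swap)).comp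
      (Continuous.prodMk_left t)
  refine hclosed.closure_subset_iff.2 (fun x hx => ?_) (hS.dense_domain z)
  rw [mem_ofPred_eq, hS.resolvent_eq t ht ⟨x, hx⟩, add_sub_cancel_left]
  exact fracConv_mem_graph hS.isClosed hα (hc.comp (Continuous.prodMk_left x))
    (hc.comp (Continuous.prodMk_left _)) ht
    fun s hs => hS.apply_mem_graph hs.1 (A.mem_graph ⟨x, hx⟩)

lemma fracConv_opConv_mem_graph (hS : IsResolventFamily α A S)
    (hc : Continuous fun p : ℝ × X => S p.1 p.2) (hα : 0 < α) (hf : Continuous f) (ht : 0 ≤ t) :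
    (fracConv α (opConv S f) t, opConv S f t - fracConv 1 f t) ∈ A.graph := by
  have hSf : Continuous fun s => S (t - s) (f s) :=
    hc.comp (by fun_prop : Continuous fun s => (t - s, f s))
  have hcont : Continuous fun τ => fracConv α (fun s => S s (f τ)) (t - τ) :=
    (continuous_uncurry_fracConv hα (F := fun τ s => S s (f τ))
      (hc.comp (by fun_prop : Continuous fun p : ℝ × ℝ => (p.2, f p.1)))).comp
      (by fun_prop : Continuous fun τ => (τ, t - τ))
  rw [fracConv_opConv_eq_integral hc hα hf ht, opConv_apply, fracConv_one,
    ← intervalIntegral.integral_sub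
    (hSf.intervalIntegrable _ _) (hf.intervalIntegrable _ _)]
  exact prodMk_intervalIntegral_mem_of_isClosed (K := A.graph.restrictScalars ℝ) hS.isClosed ht
    (hcont.intervalIntegrable _ _) ((hSf.sub hf).intervalIntegrable _ _)
    fun s hs => hS.fracConv_apply_mem_graph hc hα (sub_nonneg.2 hs.2) (f s)

lemma opConv_mem_graph (hS : IsResolventFamily α A S)
    (hc : Continuous fun p : ℝ × X => S p.1 p.2) (hf : Continuous f) (hg : Continuous g)
    (ht : 0 ≤ t) (hfg : ∀ s ∈ Icc 0 t, (f s, g s) ∈ A.graph) :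
    (opConv S f t, opConv S g t) ∈ A.graph := by
  simp only [opConv_apply]
  refine prodMk_intervalIntegral_mem_of_isClosed (K := A.graph.restrictScalars ℝ) hS.isClosed ht
    ((hc.comp (by fun_prop : Continuous fun s => (t - s, f s))).intervalIntegrable _ _)
    ((hc.comp (by fun_prop : Continuous fun s => (t - s, g s))).intervalIntegrable _ _)
    fun s hs => hS.apply_mem_graph (sub_nonneg.2 hs.2) (hfg s hs)

lemma opConv_eq_fracConv_one_of_mem_graph (hS : IsResolventFamily α A S)
    (hc : Continuous fun p : ℝ × X => S p.1 p.2) (hα : 0 < α) (hf : Continuous f)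
    (hm : Continuous m) (ht : 0 ≤ t)
    (h : ∀ s ∈ Icc 0 t, (fracConv α m s, m s - f s) ∈ A.graph) :
    opConv S f t = fracConv 1 m t := by
  -- Both `S * m - S * f` and `S * m - 1 * m` are the value of `A` at `g_α * (S * m)`.
  have hleft : (opConv S (fracConv α m) t, opConv S (fun s => m s - f s) t) ∈ A.graph :=
    hS.opConv_mem_graph hc (continuous_fracConv hα hm) (hm.sub hf) ht h
  rw [opConv_fracConv hc hα hm ht] at hleft
  have hsub : opConv S (fun s => m s - f s) t = opConv S m t - opConv S f t :=
    kernelConv_sub (fun _ _ => intervalIntegrable_const) hc hm hf t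
  exact sub_right_injective <| hsub.symm.trans <|
    A.mem_graph_snd_inj' hleft (hS.fracConv_opConv_mem_graph hc hα hm ht) rfl

lemma mem_graph_of_opConv_eq_fracConv_one (hS : IsResolventFamily α A S)
    (hc : Continuous fun p : ℝ × X => S p.1 p.2) (hα : 0 < α) (hr : 0 < r) (hf : Continuous f)
    (hm : Continuous m) (h : EqOn (opConv S f) (fracConv 1 m) (Icc 0 r)) :
    ∀ t ∈ Icc 0 r, (fracConv α m t, m t - f t) ∈ A.graph := by
  refine prodMk_mem_of_prodMk_fracConv_one_mem (K := A.graph.restrictScalars ℝ) hS.isClosed hr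
    (continuous_fracConv hα hm) (hm.sub hf) fun t ht => ?_
  have hmem := hS.fracConv_opConv_mem_graph hc hα hf ht.1
  rwa [fracConv_congr α ht.1 (h.mono (Icc_subset_Icc_right ht.2)), h ht,
    fracConv_fracConv hα one_pos hm ht.1, add_comm, ← fracConv_fracConv one_pos hα hm ht.1,
    ← fracConv_sub one_pos hm hf] at hmem

end IsResolventFamily

section Semivariation

variable {𝕜 X : Type*} [RCLike 𝕜] [NormedAddCommGroup X] [NormedSpace 𝕜 X] {a b : ℝ}
  {G H : ℝ → X →L[𝕜] X}

lemma Subdivision.mem_Icc (p : Subdivision a b) (i : Fin (p.n + 1)) : p.d i ∈ Icc a b :=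
  ⟨p.first.symm.trans_le (p.strictMono.monotone (Fin.zero_le i)),
    (p.strictMono.monotone (Fin.le_last i)).trans_eq p.last⟩

lemma semivariation_congr (h : EqOn G H (Icc a b)) :
    semivariation a b G = semivariation a b H := by
  simp only [semivariation, semivariationOn, h (Subdivision.mem_Icc _ _)]

lemma semivariation_le_of_le_left {c : ℝ} (hac : a ≤ c) :
    semivariation c b G ≤ semivariation a b G := by
  obtain rfl | hac := hac.eq_or_lt
  · exact le_rfl
  refine iSup_le fun p => iSup₂_le fun x hx => ?_
  refine le_iSup_of_le ⟨p.n + 1, Fin.cons a p.d, Fin.strictMono_cons.2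
    ⟨fun i => hac.trans_le (p.mem_Icc i).1, p.strictMono⟩, by simp,
    by rw [← Fin.succ_last, Fin.cons_succ, p.last]⟩ ?_
  refine le_iSup₂_of_le (Fin.cons 0 x) (Fin.forall_fin_succ.2 ⟨by simp, by simpa using hx⟩) ?_
  simp [Fin.sum_univ_succ]

lemma semivariation_le_of_le_right {c : ℝ} (hcb : c ≤ b) :
    semivariation a c G ≤ semivariation a b G := by
  obtain rfl | hcb := hcb.eq_or_lt
  · exact le_rfl
  refine iSup_le fun p => iSup₂_le fun x hx => ?_
  have hmono : StrictMono (Fin.snoc p.d b : Fin (p.n + 1 + 1) → ℝ) := by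
    rw [← Fin.insertNth_last', Fin.strictMono_insertNth_iff]
    exact ⟨p.strictMono, fun i _ => (p.mem_Icc i).2.trans_lt hcb,
      fun i hi => absurd hi (Fin.castSucc_lt_last i).not_ge⟩
  refine le_iSup_of_le ⟨p.n + 1, Fin.snoc p.d b, hmono,
    (Fin.snoc_castSucc (α := fun _ => ℝ) b p.d 0).trans p.first, Fin.snoc_last _ _⟩ ?_
  refine le_iSup₂_of_le (Fin.snoc x 0) (Fin.forall_fin_succ'.2 ⟨by simpa using hx, by simp⟩) ?_
  simp [Fin.sum_univ_castSucc, Fin.succ_castSucc, -Fin.castSucc_succ]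

lemma HasBoundedSemivariation.norm_sum_le (hG : HasBoundedSemivariation a b G)
    (p : Subdivision a b) {M : ℝ} (hM : 0 ≤ M) {x : Fin p.n → X} (hx : ∀ i, ‖x i‖ ≤ M) :
    ‖∑ i, (G (p.d i.succ) - G (p.d i.castSucc)) (x i)‖ ≤ (semivariation a b G).toReal * M := by
  obtain rfl | hM := hM.eq_or_lt
  · simp [fun i => norm_le_zero_iff.1 (hx i)]
  set c : 𝕜 := (M : 𝕜)⁻¹
  have hc : ‖c‖ = M⁻¹ := by simp [c, abs_of_pos hM]
  have hcx (i : Fin p.n) : ‖c • x i‖ ≤ 1 := by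
    rw [norm_smul, hc, inv_mul_le_one₀ hM]
    exact hx i
  have hsum : ‖∑ i, (G (p.d i.succ) - G (p.d i.castSucc)) (c • x i)‖ₑ ≤ semivariation a b G :=
    le_iSup_of_le p (le_iSup₂_of_le (fun i => c • x i) hcx le_rfl)
  have hnorm := ENNReal.toReal_mono hG.ne hsum
  simp only [map_smul, ← Finset.smul_sum] at hnorm
  rwa [toReal_enorm, norm_smul, hc, inv_mul_le_iff₀ hM, mul_comm] at hnorm

lemma HasBoundedSemivariation.norm_sum_range_le (hG : HasBoundedSemivariation a b G) {d : ℕ → ℝ}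
    (hd : StrictMono d) {n : ℕ} (ha : a ≤ d 0) (hb : d n ≤ b) {M : ℝ} (hM : 0 ≤ M) {x : ℕ → X}
    (hx : ∀ i < n, ‖x i‖ ≤ M) :
    ‖∑ i ∈ Finset.range n, (G (d (i + 1)) - G (d i)) (x i)‖ ≤ (semivariation a b G).toReal * M := by
  have hle : semivariation (d 0) (d n) G ≤ semivariation a b G :=
    (semivariation_le_of_le_left ha).trans (semivariation_le_of_le_right hb)
  have hG' : HasBoundedSemivariation (d 0) (d n) G := hle.trans_lt hG
  have hsum := hG'.norm_sum_le ⟨n, fun i => d i, hd.comp Fin.val_strictMono, rfl, rfl⟩ hM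
    (x := fun i => x i) fun i => hx i i.2
  rw [Finset.sum_range fun i => (G (d (i + 1)) - G (d i)) (x i)]
  exact hsum.trans (mul_le_mul_of_nonneg_right (ENNReal.toReal_mono hG.ne hle) hM)

end Semivariation

lemma integral_zero_nat_mul {E : Type*} [NormedAddCommGroup E] [NormedSpace ℝ E] {f : ℝ → E}
    (hf : Continuous f) (n : ℕ) (h : ℝ) :
    ∫ s in (0 : ℝ)..n * h, f s = ∫ s in (0 : ℝ)..h, ∑ i ∈ Finset.range n, f (i * h + s) := by
  have hadd := intervalIntegral.sum_integral_adjacent_intervals (f := f) (μ := volume)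
    (a := fun i : ℕ => i * h) (n := n) fun i _ => hf.intervalIntegrable _ _
  rw [Nat.cast_zero, zero_mul] at hadd
  rw [← hadd, intervalIntegral.integral_finsetSum fun (i : ℕ) _ =>
    (by fun_prop : Continuous fun s : ℝ => f (i * h + s)).intervalIntegrable _ _]
  refine Finset.sum_congr rfl fun i _ => ?_
  rw [intervalIntegral.integral_comp_add_left, add_zero, Nat.cast_succ, add_one_mul]

section DerivOpConv

variable {𝕜 X : Type*} [RCLike 𝕜] [NormedAddCommGroup X] [NormedSpace ℝ X] [NormedSpace 𝕜 X]
  {S : ℝ → X →L[𝕜] X} {f k : ℝ → X} {r h t M : ℝ}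

lemma opConv_add_apply_sub (hS : Continuous fun p : ℝ × X => S p.1 p.2) (hf : Continuous f)
    (t h : ℝ) :
    opConv S f (t + h) - opConv S f t - opConv S (fun s => f (t + s)) h =
      ∫ s in (0 : ℝ)..t, (S (s + h) - S s) (f (t - s)) := by
  have hlong : Continuous fun s => S s (f (t + h - s)) :=
    hS.comp (by fun_prop : Continuous fun s => (s, f (t + h - s)))
  have hshift : Continuous fun s => S (s + h) (f (t - s)) :=
    hS.comp (by fun_prop : Continuous fun s => (s + h, f (t - s)))
  have hshort : Continuous fun s => S s (f (t - s)) :=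
    hS.comp (by fun_prop : Continuous fun s => (s, f (t - s)))
  have hsubst : ∫ s in (0 : ℝ)..t, S (s + h) (f (t - s)) =
      ∫ s in h..t + h, S s (f (t + h - s)) := by
    simpa using intervalIntegral.integral_comp_add_right (a := 0) (b := t)
      (fun s => S s (f (t + h - s))) h
  simp only [_root_.sub_apply, opConv_apply_flip, ← add_sub_assoc]
  rw [intervalIntegral.integral_sub (hshift.intervalIntegrable _ _)
    (hshort.intervalIntegrable _ _), hsubst, sub_right_comm,
    intervalIntegral.integral_interval_sub_left (hlong.intervalIntegrable _ _)
      (hlong.intervalIntegrable _ _)]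

lemma norm_integral_sub_apply_le (hS : Continuous fun p : ℝ × X => S p.1 p.2)
    (hSV : HasBoundedSemivariation 0 r S) (hf : Continuous f) (hM : ∀ s ∈ Icc 0 r, ‖f s‖ ≤ M)
    {n : ℕ} (hh : 0 < h) (hr : (n + 1) * h ≤ r) :
    ‖∫ s in (0 : ℝ)..n * h, (S (s + h) - S s) (f (n * h - s))‖ ≤
      h * ((semivariation 0 r S).toReal * M) := by
  have hcont : Continuous fun s => (S (s + h) - S s) (f (n * h - s)) :=
    (hS.comp (by fun_prop : Continuous fun s => (s + h, f (n * h - s)))).sub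
      (hS.comp (by fun_prop : Continuous fun s => (s, f (n * h - s))))
  have hM0 : 0 ≤ M := (norm_nonneg _).trans (hM 0 ⟨le_rfl, le_trans (by positivity) hr⟩)
  -- For each `s ∈ [0, h]` the sum below is a semivariation sum for the points `i * h + s`.
  rw [integral_zero_nat_mul hcont]
  have hbound : ∀ s ∈ uIoc 0 h, ‖∑ i ∈ Finset.range n,
      (S (i * h + s + h) - S (i * h + s)) (f (n * h - (i * h + s)))‖ ≤
        (semivariation 0 r S).toReal * M := by
    intro s hs
    rw [uIoc_of_le hh.le] at hs
    have hmono : StrictMono fun i : ℕ => i * h + s := fun i j hij =>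
      add_lt_add_left (mul_lt_mul_of_pos_right (Nat.cast_lt.2 hij) hh) s
    have hsum := hSV.norm_sum_range_le hmono (n := n) (by simpa using hs.1.le) (by linarith [hs.2])
      hM0 (x := fun i => f (n * h - (i * h + s))) fun i hi => hM _ ?_
    · simpa only [Nat.cast_succ, add_one_mul, add_right_comm] using hsum
    · have hi' : (i + 1 : ℝ) * h ≤ n * h :=
        mul_le_mul_of_nonneg_right (by exact_mod_cast hi) hh.le
      have hi0 : 0 ≤ (i : ℝ) * h := by positivity
      constructor <;> linarith [hs.1, hs.2]
  calc _ ≤ (semivariation 0 r S).toReal * M * |h - 0| :=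
        intervalIntegral.norm_integral_le_of_norm_le_const hbound
    _ = _ := by rw [sub_zero, abs_of_pos hh, mul_comm]

variable [CompleteSpace X]

lemma tendsto_inv_smul_opConv (hS : Continuous fun p : ℝ × X => S p.1 p.2) (hf : Continuous f) :
    Tendsto (fun h : ℝ => h⁻¹ • opConv S f h) (𝓝[≠] 0) (𝓝 (S 0 (f 0))) := by
  -- The substitution `s = h σ` turns the quotient into `∫₀¹ S(h - h σ) f(h σ) dσ`.
  have hF : Continuous (Function.uncurry fun h σ : ℝ => S (h - h * σ) (f (h * σ))) :=
    hS.comp (by fun_prop : Continuous fun p : ℝ × ℝ => (p.1 - p.1 * p.2, f (p.1 * p.2)))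
  have hcont := intervalIntegral.continuous_parametric_intervalIntegral_of_continuous'
    (μ := volume) hF 0 1
  have hlim := (hcont.tendsto 0).mono_left (nhdsWithin_le_nhds (s := {0}ᶜ))
  simp only [zero_mul, sub_zero, intervalIntegral.integral_const, one_smul] at hlim
  refine hlim.congr' (eventually_nhdsWithin_of_forall fun h (hh : h ≠ 0) => ?_)
  rw [eq_inv_smul_iff₀ hh, opConv_apply,
    intervalIntegral.smul_integral_comp_mul_left (fun s => S (h - s) (f s)), mul_zero, mul_one]

lemma norm_sub_apply_le_of_mem_Ioo (hS : Continuous fun p : ℝ × X => S p.1 p.2)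
    (hSV : HasBoundedSemivariation 0 r S) (hf : Continuous f) (hk : Continuous k)
    (hfk : EqOn (opConv S f) (fracConv 1 k) (Icc 0 r)) (hM : ∀ s ∈ Icc 0 r, ‖f s‖ ≤ M)
    (ht : t ∈ Ioo 0 r) : ‖k t - S 0 (f t)‖ ≤ (semivariation 0 r S).toReal * M := by
  set h : ℕ → ℝ := fun n => t / n
  have hh : Tendsto h atTop (𝓝[≠] 0) := tendsto_nhdsWithin_iff.2
    ⟨tendsto_const_div_atTop_nhds_zero_nat t, (eventually_ne_atTop 0).mono fun n hn =>
      div_ne_zero ht.1.ne' (Nat.cast_ne_zero.2 hn)⟩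
  have hderiv := (hasDerivAt_iff_tendsto_slope_zero.1 (hasDerivAt_fracConv_one hk t)).comp hh
  have hzero : Tendsto (fun n => (h n)⁻¹ • opConv S (fun s => f (t + s)) (h n)) atTop
      (𝓝 (S 0 (f t))) := by
    simpa [Function.comp_def] using
      (tendsto_inv_smul_opConv hS (f := fun s => f (t + s)) (by fun_prop)).comp hh
  refine le_of_tendsto (hderiv.sub hzero).norm ?_
  have hsmall : ∀ᶠ n in atTop, h n < r - t :=
    (hh.mono_right nhdsWithin_le_nhds).eventually (gt_mem_nhds (sub_pos.2 ht.2))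
  filter_upwards [hsmall, eventually_gt_atTop 0] with n hn hn0
  have hn0' : (0 : ℝ) < n := Nat.cast_pos.2 hn0
  have hpos : 0 < h n := div_pos ht.1 hn0'
  have hnh : n * h n = t := mul_div_cancel₀ t hn0'.ne'
  have hle := norm_integral_sub_apply_le hS hSV hf hM hpos (n := n) (by linarith)
  rw [hnh, ← opConv_add_apply_sub hS hf, hfk ⟨ht.1.le, ht.2.le⟩,
    hfk ⟨by linarith [ht.1], by linarith⟩] at hle
  simp only [Function.comp_apply, ← smul_sub, norm_smul, norm_inv, Real.norm_of_nonneg hpos.le]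
  rwa [inv_mul_le_iff₀ hpos]

lemma norm_sub_apply_le_of_opConv_eqOn (hS : Continuous fun p : ℝ × X => S p.1 p.2)
    (hr : 0 < r) (hSV : HasBoundedSemivariation 0 r S) (hf : Continuous f) (hk : Continuous k)
    (hfk : EqOn (opConv S f) (fracConv 1 k) (Icc 0 r)) (hM : ∀ s ∈ Icc 0 r, ‖f s‖ ≤ M)
    (ht : t ∈ Icc 0 r) : ‖k t - S 0 (f t)‖ ≤ (semivariation 0 r S).toReal * M := by
  have hclosed : IsClosed {t | ‖k t - S 0 (f t)‖ ≤ (semivariation 0 r S).toReal * M} :=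
    isClosed_le (by fun_prop) continuous_const
  rw [← closure_Ioo hr.ne] at ht
  exact closure_minimal
    (fun s hs => norm_sub_apply_le_of_mem_Ioo hS hSV hf hk hfk hM hs) hclosed ht

end DerivOpConv

section RangeInclusion

variable {𝕜 E F G : Type*} [NontriviallyNormedField 𝕜] [NormedAddCommGroup E] [NormedSpace 𝕜 E]
  [NormedAddCommGroup F] [NormedSpace 𝕜 F] [NormedAddCommGroup G] [NormedSpace 𝕜 G]
  [CompleteSpace F] {Φ : E →L[𝕜] G} {V : F →L[𝕜] G}

lemma mem_range_of_dense_of_norm_le {C : ℝ} (hdense : Dense {f | Φ f ∈ range V})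
    (hbound : ∀ f k, Φ f = V k → ‖k‖ ≤ C * ‖f‖) (f : E) : Φ f ∈ range V := by
  obtain ⟨g, hg, hgf⟩ := mem_closure_iff_seq_limit.1 (hdense f)
  choose k hk using hg
  have hcauchy : CauchySeq k := by
    have hgdist := (cauchySeq_iff_tendsto_dist_atTop_0.1 hgf.cauchySeq).const_mul C
    rw [mul_zero] at hgdist
    refine cauchySeq_iff_tendsto_dist_atTop_0.2 (squeeze_zero (fun _ => dist_nonneg)
      (fun n => ?_) hgdist)
    simp only [dist_eq_norm]
    exact hbound _ _ (by rw [map_sub, map_sub, hk, hk])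
  obtain ⟨l, hl⟩ := cauchySeq_tendsto_of_complete hcauchy
  refine ⟨l, tendsto_nhds_unique ((V.continuous.tendsto l).comp hl) ?_⟩
  exact ((Φ.continuous.tendsto f).comp hgf).congr fun n => (hk n).symm

lemma exists_comp_eq_of_forall_mem_range [CompleteSpace E] (hV : Function.Injective V)
    (hrange : ∀ f, Φ f ∈ range V) : ∃ T : E →L[𝕜] F, V ∘L T = Φ := by
  let e := LinearEquiv.ofInjective (V : F →ₗ[𝕜] G) hV
  let T : E →ₗ[𝕜] F := e.symm ∘ₗ (Φ : E →ₗ[𝕜] G).codRestrict (V : F →ₗ[𝕜] G).range hrange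
  have hVT (f : E) : V (T f) = Φ f := congrArg Subtype.val (e.apply_symm_apply _)
  have hgraph : (T.graph : Set (E × F)) = {p | Φ p.1 = V p.2} := by
    ext ⟨f, k⟩
    simp only [SetLike.mem_coe, LinearMap.mem_graph_iff, mem_ofPred_eq, ← hVT]
    exact ⟨fun h => h ▸ rfl, fun h => hV h.symm⟩
  have hclosed : IsClosed (T.graph : Set (E × F)) := by
    rw [hgraph]
    exact isClosed_eq (by fun_prop) (by fun_prop)
  exact ⟨.ofIsClosedGraph hclosed, ContinuousLinearMap.ext hVT⟩

end RangeInclusion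

section KernelConvCLM

variable {𝕜 X : Type*} [RCLike 𝕜] [NormedAddCommGroup X] [NormedSpace ℝ X] [NormedSpace 𝕜 X]
  [IsScalarTower ℝ 𝕜 X] {φ : ℝ → ℝ} {T : ℝ → X →L[𝕜] X} {r : ℝ}

/-- Convolution with the kernel `φ T` as a bounded operator on `C([0,r];X)`; a function on `[0,r]`
is extended to `ℝ` by its boundary values, which does not affect the convolution on `[0,r]`. -/
noncomputable def kernelConvCLM (hφ : ∀ a b, IntervalIntegrable φ volume a b)
    (hT : Continuous fun p : ℝ × X => T p.1 p.2) (hr : 0 ≤ r) :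
    C(Icc 0 r, X) →L[𝕜] C(Icc 0 r, X) where
  toFun f := ⟨fun t => kernelConv φ T (IccExtend hr f) t,
    (continuous_kernelConv hφ hT f.continuous.Icc_extend').comp continuous_subtype_val⟩
  map_add' f g := ContinuousMap.ext fun t =>
    kernelConv_add hφ hT f.continuous.Icc_extend' g.continuous.Icc_extend' t
  map_smul' c f := ContinuousMap.ext fun t => kernelConv_const_smul φ T c (IccExtend hr f) t
  cont := by
    have hF : Continuous (Function.uncurry fun (f : C(Icc 0 r, X)) s => IccExtend hr f s) := by
      simp only [IccExtend, Function.comp_def]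
      fun_prop
    exact (ContinuousMap.curry ⟨fun p : C(Icc 0 r, X) × Icc 0 r =>
      kernelConv φ T (IccExtend hr p.1) p.2, (continuous_uncurry_kernelConv hφ hT hF).comp
        (by fun_prop : Continuous fun p : C(Icc 0 r, X) × Icc 0 r => (p.1, (p.2 : ℝ)))⟩).continuous

end KernelConvCLM

section SmoothTransition

lemma hasDerivAt_smoothTransition (s : ℝ) :
    HasDerivAt Real.smoothTransition (deriv Real.smoothTransition s) s :=
  ((Real.smoothTransition.contDiff (n := 1)).differentiable one_ne_zero s).hasDerivAt

@[fun_prop]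
lemma continuous_deriv_smoothTransition : Continuous (deriv Real.smoothTransition) :=
  (Real.smoothTransition.contDiff (n := 1)).continuous_deriv le_rfl

lemma support_deriv_smoothTransition_subset :
    Function.support (deriv Real.smoothTransition) ⊆ Ioo 0 1 := by
  intro s hs
  by_contra hs'
  rcases le_or_gt s 0 with h0 | h0
  · exact hs (IsLocalMin.deriv_eq_zero (Eventually.of_forall fun t => by
      rw [Real.smoothTransition.zero_of_nonpos h0]
      exact Real.smoothTransition.nonneg t))
  · exact hs (IsLocalMax.deriv_eq_zero (Eventually.of_forall fun t => by
      rw [Real.smoothTransition.one_of_one_le (not_lt.1 fun h1 => hs' ⟨h0, h1⟩)]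
      exact Real.smoothTransition.le_one t))

lemma integral_deriv_smoothTransition :
    ∫ σ in (0 : ℝ)..1, deriv Real.smoothTransition σ = 1 := by
  rw [intervalIntegral.integral_eq_sub_of_hasDerivAt (fun s _ => hasDerivAt_smoothTransition s)
    (continuous_deriv_smoothTransition.intervalIntegrable _ _), Real.smoothTransition.one,
    Real.smoothTransition.zero, sub_zero]

lemma integral_deriv_smoothTransition_div_smul {E : Type*} [NormedAddCommGroup E] [NormedSpace ℝ E]
    (g : ℝ → E) {c δ r : ℝ} (hc : 0 ≤ c) (hδ : 0 < δ) (hr : c + δ ≤ r) :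
    ∫ s in (0 : ℝ)..r, (deriv Real.smoothTransition ((s - c) / δ) / δ) • g s =
      ∫ σ in (0 : ℝ)..1, deriv Real.smoothTransition σ • g (c + δ * σ) := by
  have hsupp : Function.support (fun σ => deriv Real.smoothTransition σ • g (c + δ * σ)) ⊆
      Ioo 0 1 :=
    (Function.support_smul_subset_left _ _).trans support_deriv_smoothTransition_subset
  have hleft : -c / δ ≤ 0 := div_nonpos_of_nonpos_of_nonneg (neg_nonpos.2 hc) hδ.le
  have hright : 1 ≤ (r - c) / δ := (one_le_div hδ).2 (by linarith)
  calc ∫ s in (0 : ℝ)..r, (deriv Real.smoothTransition ((s - c) / δ) / δ) • g s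
      = ∫ σ in -c / δ..(r - c) / δ, deriv Real.smoothTransition σ • g (c + δ * σ) := by
        have hsubst := intervalIntegral.smul_integral_comp_add_mul (a := -c / δ) (b := (r - c) / δ)
          (fun s => (deriv Real.smoothTransition ((s - c) / δ) / δ) • g s) δ c
        simp only [mul_div_cancel₀ _ hδ.ne', add_neg_cancel, add_sub_cancel, add_sub_cancel_left,
          mul_div_cancel_left₀ _ hδ.ne'] at hsubst
        rw [← hsubst, ← intervalIntegral.integral_smul]
        simp only [smul_smul, mul_div_cancel₀ _ hδ.ne']
    _ = ∫ σ in (0 : ℝ)..1, deriv Real.smoothTransition σ • g (c + δ * σ) := by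
        rw [intervalIntegral.integral_eq_integral_of_support_subset
          (hsupp.trans (Ioo_subset_Ioc_self.trans (Ioc_subset_Ioc hleft hright))),
          intervalIntegral.integral_eq_integral_of_support_subset
          (hsupp.trans Ioo_subset_Ioc_self)]

end SmoothTransition

section SmoothStep

variable {X : Type*} [NormedAddCommGroup X] [NormedSpace ℝ X] {r : ℝ}

lemma norm_sum_sub_smul_le_one {n : ℕ} {w : Fin (n + 1) → ℝ} (hw : Antitone w)
    (h0 : 0 ≤ w (Fin.last n)) (h1 : w 0 ≤ 1) {x : Fin n → X} (hx : ∀ i, ‖x i‖ ≤ 1) :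
    ‖∑ i : Fin n, (w i.castSucc - w i.succ) • x i‖ ≤ 1 := by
  have hnonneg (i : Fin n) : 0 ≤ w i.castSucc - w i.succ :=
    sub_nonneg.2 (hw (Fin.castSucc_lt_succ).le)
  calc ‖∑ i : Fin n, (w i.castSucc - w i.succ) • x i‖
      ≤ ∑ i : Fin n, (w i.castSucc - w i.succ) := norm_sum_le_of_le _ fun i _ => by
        rw [norm_smul, Real.norm_of_nonneg (hnonneg i)]
        exact mul_le_of_le_one_right (hnonneg i) (hx i)
    _ = w 0 - w (Fin.last n) := by
        have hsplit := (Fin.sum_univ_castSucc w).symm.trans (Fin.sum_univ_succ w)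
        rw [Finset.sum_sub_distrib]
        linarith
    _ ≤ 1 := by linarith

/-- The function `s ↦ ρ((r - s - c) / δ) z` on `[0,r]`, for a smooth transition `ρ` from `0` to `1`:
a mollified indicator of `[0, r - c]`, falling from `z` to `0` on `[r - c - δ, r - c]`. The
derivative at `r` of its convolution with `S` approximates `S(r) z - S(c) z`. -/
noncomputable def smoothStep (r c δ : ℝ) (z : X) : C(Icc 0 r, X) where
  toFun s := Real.smoothTransition ((r - s - c) / δ) • z

lemma norm_sum_smoothStep_sub_le_one {n : ℕ} {c : Fin (n + 1) → ℝ} (hc : Monotone c) {δ : ℝ}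
    (hδ : 0 ≤ δ) {x : Fin n → X} (hx : ∀ i, ‖x i‖ ≤ 1) :
    ‖∑ i, (smoothStep r (c i.castSucc) δ (x i) - smoothStep r (c i.succ) δ (x i))‖ ≤ 1 := by
  refine (ContinuousMap.norm_le _ zero_le_one).2 fun s => ?_
  have hanti : Antitone fun i => Real.smoothTransition ((r - s - c i) / δ) := fun i j hij =>
    Real.smoothTransition.monotone
      (div_le_div_of_nonneg_right (sub_le_sub_left (hc hij) _) hδ)
  simpa [smoothStep, sub_smul] using norm_sum_sub_smul_le_one hanti
    (Real.smoothTransition.nonneg _) (Real.smoothTransition.le_one _) hx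

end SmoothStep

section DerivOpConvSmoothStep

variable {𝕜 X : Type*} [RCLike 𝕜] [NormedAddCommGroup X] [NormedSpace ℝ X] [NormedSpace 𝕜 X]
  [CompleteSpace X] {S : ℝ → X →L[𝕜] X} {r c δ : ℝ}

lemma opConv_eq_fracConv_one_of_hasDerivAt [IsScalarTower ℝ 𝕜 X]
    (hS : Continuous fun p : ℝ × X => S p.1 p.2) {f f' : ℝ → X} (hf : ∀ s, HasDerivAt f (f' s) s)
    (hf' : Continuous f') {t : ℝ} (ht : 0 ≤ t) :
    opConv S f t = fracConv 1 (fun s => S s (f 0) + opConv S f' s) t := by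
  rw [← opConv_const_add_fracConv_one hS _ hf' ht]
  congr 1
  ext s
  rw [fracConv_one, intervalIntegral.integral_eq_sub_of_hasDerivAt (fun s _ => hf s)
    (hf'.intervalIntegrable _ _), add_sub_cancel]

lemma eq_sub_integral_of_opConv_smoothTransition_eqOn [IsScalarTower ℝ 𝕜 X]
    (hS : Continuous fun p : ℝ × X => S p.1 p.2) (hc : 0 ≤ c) (hδ : 0 < δ) (hr : c + δ ≤ r)
    (z : X) {k : ℝ → X} (hk : Continuous k)
    (hfk : EqOn (opConv S fun s => Real.smoothTransition ((r - s - c) / δ) • z) (fracConv 1 k)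
      (Icc 0 r)) :
    k r = S r z - ∫ σ in (0 : ℝ)..1, deriv Real.smoothTransition σ • S (c + δ * σ) z := by
  set f : ℝ → X := fun s => Real.smoothTransition ((r - s - c) / δ) • z
  set f' : ℝ → X := fun s => -((deriv Real.smoothTransition ((r - s - c) / δ) / δ) • z)
  have hr0 : 0 < r := by linarith
  have hf' : Continuous f' := by fun_prop
  have hff' (s : ℝ) : HasDerivAt f (f' s) s := by
    have hinner : HasDerivAt (fun s => (r - s - c) / δ) (-1 / δ) s :=
      (((hasDerivAt_id s).const_sub r).sub_const c).div_const δ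
    refine (((hasDerivAt_smoothTransition _).comp s hinner).smul_const z).congr_deriv ?_
    rw [mul_div_assoc', mul_neg_one, neg_div, neg_smul]
  have hf0 : f 0 = z := by
    simp only [f, sub_zero]
    rw [Real.smoothTransition.one_of_one_le ((one_le_div hδ).2 (by linarith)), one_smul]
  have hderiv : k r = S r (f 0) + opConv S f' r := eqOn_of_eqOn_fracConv_one hr0 hk
    (g := fun s => S s (f 0) + opConv S f' s)
    ((hS.comp (Continuous.prodMk_left (f 0))).add (continuous_opConv hS hf'))
    (fun t ht => (hfk ht).symm.trans (opConv_eq_fracConv_one_of_hasDerivAt hS hff' hf' ht.1))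
    ⟨hr0.le, le_rfl⟩
  rw [hderiv, hf0, opConv_apply_flip,
    ← integral_deriv_smoothTransition_div_smul (fun s => S s z) hc hδ hr]
  simp only [f', sub_sub_cancel, map_neg, ContinuousLinearMap.map_smul_of_tower,
    intervalIntegral.integral_neg, ← sub_eq_add_neg]

lemma tendsto_sub_integral_deriv_smoothTransition_smul
    (hS : Continuous fun p : ℝ × X => S p.1 p.2) (r d : ℝ) (z : X) :
    Tendsto (fun ε : ℝ => S r z - ∫ σ in (0 : ℝ)..1,
      deriv Real.smoothTransition σ • S ((1 - ε) * d + ε * r * σ) z) (𝓝 0)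
      (𝓝 (S r z - S d z)) := by
  have hF : Continuous (Function.uncurry fun ε σ : ℝ =>
      deriv Real.smoothTransition σ • S ((1 - ε) * d + ε * r * σ) z) :=
    (continuous_deriv_smoothTransition.comp continuous_snd).smul (hS.comp
      (by fun_prop : Continuous fun p : ℝ × ℝ => ((1 - p.1) * d + p.1 * r * p.2, z)))
  have hlim := (intervalIntegral.continuous_parametric_intervalIntegral_of_continuous'
    (μ := volume) hF 0 1).tendsto 0
  simp only [sub_zero, one_mul, zero_mul, add_zero, intervalIntegral.integral_smul_const,
    integral_deriv_smoothTransition, one_smul] at hlim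
  exact tendsto_const_nhds.sub hlim

end DerivOpConvSmoothStep

section ConvolutionRegularity

variable {𝕜 X : Type*} [RCLike 𝕜] [NormedAddCommGroup X] [NormedSpace ℝ X] [NormedSpace 𝕜 X]
  [IsScalarTower ℝ 𝕜 X] {S : ℝ → X →L[𝕜] X} {r : ℝ}

/-- The operator `f ↦ S * f` on `C([0,r];X)`. -/
noncomputable def opConvCLM (hS : Continuous fun p : ℝ × X => S p.1 p.2) (hr : 0 ≤ r) :
    C(Icc 0 r, X) →L[𝕜] C(Icc 0 r, X) :=
  kernelConvCLM (φ := fun _ => 1) (fun _ _ => intervalIntegrable_const) hS hr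

variable (𝕜 X) in
/-- The integration operator `(1 * k)(t) = ∫₀ᵗ k(s) ds` on `C([0,r];X)`. -/
noncomputable def integralCLM (hr : 0 ≤ r) : C(Icc 0 r, X) →L[𝕜] C(Icc 0 r, X) :=
  kernelConvCLM (φ := fracKernel 1) (T := fun _ => .id 𝕜 X) (intervalIntegrable_fracKernel one_pos)
    continuous_snd hr

lemma opConvCLM_eq_integralCLM_iff (hS : Continuous fun p : ℝ × X => S p.1 p.2) (hr : 0 ≤ r)
    {f k : C(Icc 0 r, X)} : opConvCLM hS hr f = integralCLM 𝕜 X hr k ↔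
      EqOn (opConv S (IccExtend hr f)) (fracConv 1 (IccExtend hr k)) (Icc 0 r) := by
  rw [ContinuousMap.ext_iff, Subtype.forall]
  exact Iff.rfl

variable [CompleteSpace X]

lemma injective_integralCLM (hr : 0 < r) : Function.Injective (integralCLM 𝕜 X hr.le) := by
  intro k l hkl
  have heq : EqOn (fracConv 1 (IccExtend hr.le k)) (fracConv 1 (IccExtend hr.le l)) (Icc 0 r) :=
    fun t ht => congrArg (fun f : C(Icc 0 r, X) => f ⟨t, ht⟩) hkl
  ext t
  simpa using eqOn_of_eqOn_fracConv_one hr k.continuous.Icc_extend' l.continuous.Icc_extend' heq t.2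

lemma opConvCLM_mem_range_integralCLM_iff (hS : Continuous fun p : ℝ × X => S p.1 p.2)
    (hr : 0 < r) {f : C(Icc 0 r, X)} {g : ℝ → X} (hfg : EqOn (IccExtend hr.le f) g (Icc 0 r)) :
    opConvCLM hS hr.le f ∈ range (integralCLM 𝕜 X hr.le) ↔
      ContDiffOn ℝ 1 (opConv S g) (Icc 0 r) := by
  have hconv : EqOn (opConv S (IccExtend hr.le f)) (opConv S g) (Icc 0 r) := fun t ht =>
    opConv_congr ht.1 (eqOn_refl _ _) (hfg.mono (Icc_subset_Icc_right ht.2))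
  rw [contDiffOn_one_iff_exists_eqOn_fracConv_one hr (opConv_apply_zero S g)]
  constructor
  · rintro ⟨k, hk⟩
    exact ⟨_, k.continuous.Icc_extend',
      hconv.symm.trans ((opConvCLM_eq_integralCLM_iff hS hr.le).1 hk.symm)⟩
  · rintro ⟨k, hk, hgk⟩
    refine ⟨⟨fun t => k t, by fun_prop⟩, ((opConvCLM_eq_integralCLM_iff hS hr.le).2 ?_).symm⟩
    refine (hconv.trans hgk).trans fun t ht => fracConv_congr 1 ht.1 fun s hs => ?_
    rw [IccExtend_of_mem _ _ ⟨hs.1, hs.2.trans ht.2⟩]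
    rfl

lemma forall_opConvCLM_mem_range_integralCLM_iff (hS : Continuous fun p : ℝ × X => S p.1 p.2)
    (hr : 0 < r) : (∀ f, opConvCLM hS hr.le f ∈ range (integralCLM 𝕜 X hr.le)) ↔
      ∀ f, Continuous f → ContDiffOn ℝ 1 (opConv S f) (Icc 0 r) :=
  ⟨fun h f hf => (opConvCLM_mem_range_integralCLM_iff hS hr fun _ ht =>
      IccExtend_of_mem hr.le _ ht).1 (h ⟨fun t => f t, by fun_prop⟩),
    fun h f => (opConvCLM_mem_range_integralCLM_iff hS hr (eqOn_refl _ _)).2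
      (h _ f.continuous.Icc_extend')⟩

lemma contDiffOn_opConv_of_contDiff (hS : Continuous fun p : ℝ × X => S p.1 p.2) {f : ℝ → X}
    (hf : ContDiff ℝ 1 f) : ContDiffOn ℝ 1 (opConv S f) (Icc 0 r) := by
  obtain ⟨hdiff, hcont⟩ := contDiff_one_iff_deriv.1 hf
  exact (contDiff_one_fracConv_one ((hS.comp (Continuous.prodMk_left (f 0))).add
    (continuous_opConv hS hcont))).contDiffOn.congr fun t ht =>
      opConv_eq_fracConv_one_of_hasDerivAt hS (fun s => (hdiff s).hasDerivAt) hcont ht.1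

lemma dense_opConvCLM_preimage_range_integralCLM (hS : Continuous fun p : ℝ × X => S p.1 p.2)
    (hr : 0 < r) : Dense {f | opConvCLM hS hr.le f ∈ range (integralCLM 𝕜 X hr.le)} := by
  refine Metric.dense_iff.2 fun f ε hε => ?_
  obtain ⟨g, hg, hgf, -⟩ := (f.continuous.Icc_extend' (h := hr.le)).exists_contDiff_approx 1
    continuous_const fun _ => hε
  refine ⟨⟨fun t => g t, by have := hg.continuous; fun_prop⟩, ?_, ?_⟩
  · refine (ContinuousMap.dist_lt_iff hε).2 fun t => ?_
    simpa using hgf t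
  · exact (opConvCLM_mem_range_integralCLM_iff hS hr fun _ ht => IccExtend_of_mem hr.le _ ht).2
      (contDiffOn_opConv_of_contDiff hS hg)

lemma HasBoundedSemivariation.opConvCLM_mem_range_integralCLM
    (hS : Continuous fun p : ℝ × X => S p.1 p.2) (hr : 0 < r) (hSV : HasBoundedSemivariation 0 r S)
    (f : C(Icc 0 r, X)) : opConvCLM hS hr.le f ∈ range (integralCLM 𝕜 X hr.le) := by
  refine mem_range_of_dense_of_norm_le (C := (semivariation 0 r S).toReal + ‖S 0‖)
    (dense_opConvCLM_preimage_range_integralCLM hS hr) (fun f k hfk => ?_) f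
  refine (ContinuousMap.norm_le _ (by positivity)).2 fun t => ?_
  have hM : ∀ s ∈ Icc 0 r, ‖IccExtend hr.le f s‖ ≤ ‖f‖ := fun s _ => f.norm_coe_le_norm _
  have hsub := norm_sub_apply_le_of_opConv_eqOn hS hr hSV f.continuous.Icc_extend'
    k.continuous.Icc_extend' ((opConvCLM_eq_integralCLM_iff hS hr.le).1 hfk) hM t.2
  rw [IccExtend_val, IccExtend_val] at hsub
  calc ‖k t‖ ≤ ‖k t - S 0 (f t)‖ + ‖S 0 (f t)‖ := norm_le_norm_sub_add _ _
    _ ≤ (semivariation 0 r S).toReal * ‖f‖ + ‖S 0‖ * ‖f‖ :=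
      add_le_add hsub ((S 0).le_opNorm_of_le (f.norm_coe_le_norm t))
    _ = _ := (add_mul _ _ _).symm

lemma apply_smoothStep_apply_right (hS : Continuous fun p : ℝ × X => S p.1 p.2) (hr : 0 < r)
    {T : C(Icc 0 r, X) →L[𝕜] C(Icc 0 r, X)} (hT : integralCLM 𝕜 X hr.le ∘L T = opConvCLM hS hr.le)
    {c δ : ℝ} (hc : 0 ≤ c) (hδ : 0 < δ) (hcδ : c + δ ≤ r) (z : X) :
    T (smoothStep r c δ z) ⟨r, hr.le, le_rfl⟩ =
      S r z - ∫ σ in (0 : ℝ)..1, deriv Real.smoothTransition σ • S (c + δ * σ) z := by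
  set k := T (smoothStep r c δ z)
  have hk : EqOn (opConv S (IccExtend hr.le (smoothStep r c δ z))) (fracConv 1 (IccExtend hr.le k))
      (Icc 0 r) :=
    (opConvCLM_eq_integralCLM_iff hS hr.le).1 (DFunLike.congr_fun hT (smoothStep r c δ z)).symm
  rw [← eq_sub_integral_of_opConv_smoothTransition_eqOn hS hc hδ hcδ z k.continuous.Icc_extend'
    fun t ht => (opConv_congr ht.1 (eqOn_refl _ _) fun s hs => ?_).trans (hk ht), IccExtend_right]
  rw [IccExtend_of_mem _ _ ⟨hs.1, hs.2.trans ht.2⟩]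
  rfl

lemma norm_sum_apply_le_norm (hS : Continuous fun p : ℝ × X => S p.1 p.2) (hr : 0 < r)
    {T : C(Icc 0 r, X) →L[𝕜] C(Icc 0 r, X)} (hT : integralCLM 𝕜 X hr.le ∘L T = opConvCLM hS hr.le)
    (p : Subdivision 0 r) {x : Fin p.n → X} (hx : ∀ i, ‖x i‖ ≤ 1) :
    ‖∑ i, (S (p.d i.succ) - S (p.d i.castSucc)) (x i)‖ ≤ ‖T‖ := by
  -- Scaling the points by `1 - ε` leaves room in `[0,r]` for steps of width `ε r`.
  set f : ℝ → C(Icc 0 r, X) := fun ε =>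
    ∑ i, (smoothStep r ((1 - ε) * p.d i.castSucc) (ε * r) (x i) -
      smoothStep r ((1 - ε) * p.d i.succ) (ε * r) (x i))
  have hε : ∀ᶠ ε : ℝ in 𝓝[>] 0, ε ∈ Ioo 0 1 := Ioo_mem_nhdsGT one_pos
  have hstep (i : Fin (p.n + 1)) (z : X) :
      Tendsto (fun ε => T (smoothStep r ((1 - ε) * p.d i) (ε * r) z) ⟨r, hr.le, le_rfl⟩) (𝓝[>] 0)
        (𝓝 (S r z - S (p.d i) z)) := by
    refine ((tendsto_sub_integral_deriv_smoothTransition_smul hS r (p.d i) z).mono_left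
      nhdsWithin_le_nhds).congr' (hε.mono fun ε hε => ?_)
    obtain ⟨hd0, hdr⟩ := p.mem_Icc i
    have hle : (1 - ε) * p.d i ≤ (1 - ε) * r := mul_le_mul_of_nonneg_left hdr (sub_pos.2 hε.2).le
    exact (apply_smoothStep_apply_right hS hr hT (mul_nonneg (sub_pos.2 hε.2).le hd0)
      (mul_pos hε.1 hr) (by linarith) z).symm
  have hlim : Tendsto (fun ε => T (f ε) ⟨r, hr.le, le_rfl⟩) (𝓝[>] 0)
      (𝓝 (∑ i, (S (p.d i.succ) - S (p.d i.castSucc)) (x i))) := by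
    have hsum := tendsto_finsetSum Finset.univ fun i _ =>
      (hstep (Fin.castSucc i) (x i)).sub (hstep (Fin.succ i) (x i))
    simpa only [f, map_sum, map_sub, ContinuousMap.sum_apply, ContinuousMap.sub_apply,
      sub_sub_sub_cancel_left, _root_.sub_apply] using hsum
  refine le_of_tendsto hlim.norm (hε.mono fun ε hε => ?_)
  have hmono : Monotone fun i => (1 - ε) * p.d i :=
    p.strictMono.monotone.const_mul (sub_pos.2 hε.2).le
  calc ‖T (f ε) ⟨r, hr.le, le_rfl⟩‖ ≤ ‖T (f ε)‖ := ContinuousMap.norm_coe_le_norm _ _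
    _ ≤ ‖T‖ := T.unit_le_opNorm _ (norm_sum_smoothStep_sub_le_one hmono (by nlinarith [hε.1]) hx)

lemma hasBoundedSemivariation_of_forall_mem_range (hS : Continuous fun p : ℝ × X => S p.1 p.2)
    (hr : 0 < r) (hrange : ∀ f, opConvCLM hS hr.le f ∈ range (integralCLM 𝕜 X hr.le)) :
    HasBoundedSemivariation 0 r S := by
  obtain ⟨T, hT⟩ := exists_comp_eq_of_forall_mem_range (𝕜 := 𝕜) (Φ := opConvCLM hS hr.le)
    (V := integralCLM 𝕜 X hr.le) (injective_integralCLM hr) hrange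
  refine lt_of_le_of_lt (iSup_le fun p => iSup₂_le fun x hx => ?_)
    (ENNReal.ofReal_lt_top (r := ‖T‖))
  rw [← ofReal_norm]
  exact ENNReal.ofReal_le_ofReal (norm_sum_apply_le_norm hS hr hT p hx)

theorem hasBoundedSemivariation_iff_forall_contDiffOn_opConv
    (hS : Continuous fun p : ℝ × X => S p.1 p.2) (hr : 0 < r) :
    HasBoundedSemivariation 0 r S ↔
      ∀ f, Continuous f → ContDiffOn ℝ 1 (opConv S f) (Icc 0 r) := by
  rw [← forall_opConvCLM_mem_range_integralCLM_iff hS hr]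
  exact ⟨fun h => h.opConvCLM_mem_range_integralCLM hS hr,
    hasBoundedSemivariation_of_forall_mem_range hS hr⟩

end ConvolutionRegularity

section IntegratedProblem

variable {X : Type*} [NormedAddCommGroup X] [NormedSpace ℝ X] [CompleteSpace X]
  {α r : ℝ} {f v m : ℝ → X}

lemma eqOn_fracConv_iff_eqOn_fracConv_two_sub (hα₀ : 0 < α) (hα₂ : α < 2) (hr : 0 < r)
    (hv : Continuous v) (hm : Continuous m) : EqOn v (fracConv α m) (Icc 0 r) ↔
      EqOn (fracConv (2 - α) v) (fracConv 1 (fracConv 1 m)) (Icc 0 r) := by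
  have hα₂' : 0 < 2 - α := sub_pos.2 hα₂
  refine ⟨fun h t ht => ?_, fun h => ?_⟩
  · rw [fracConv_congr _ ht.1 (h.mono (Icc_subset_Icc_right ht.2)),
      fracConv_fracConv hα₂' hα₀ hm ht.1, fracConv_fracConv one_pos one_pos hm ht.1]
    norm_num
  · have hαm : Continuous (fracConv α m) := continuous_fracConv hα₀ hm
    -- Convolving with `g_α` turns `g_{2-α} * v` into `1 * 1 * v`, and integration is injective.
    refine eqOn_of_eqOn_fracConv_one hr hv hαm <| eqOn_of_eqOn_fracConv_one hr
      (continuous_fracConv one_pos hv) (continuous_fracConv one_pos hαm) fun t ht => ?_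
    calc fracConv 1 (fracConv 1 v) t
        = fracConv α (fracConv (2 - α) v) t := by
          rw [fracConv_fracConv one_pos one_pos hv ht.1, fracConv_fracConv hα₀ hα₂' hv ht.1]
          norm_num
      _ = fracConv α (fracConv 1 (fracConv 1 m)) t :=
          fracConv_congr α ht.1 (h.mono (Icc_subset_Icc_right ht.2))
      _ = fracConv 1 (fracConv 1 (fracConv α m)) t := by
          rw [fracConv_fracConv hα₀ one_pos (continuous_fracConv one_pos hm) ht.1,
            fracConv_fracConv (by linarith) one_pos hm ht.1,
            fracConv_fracConv one_pos one_pos hαm ht.1,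
            fracConv_fracConv (by norm_num) hα₀ hm ht.1]
          congr 1
          ring

lemma contDiffOn_one_of_contDiffOn_two_fracConv_one (hr : 0 < r) (hf : Continuous f)
    (h : ContDiffOn ℝ 2 (fracConv 1 f) (Icc 0 r)) : ContDiffOn ℝ 1 f (Icc 0 r) := by
  rw [show (2 : WithTop ℕ∞) = 1 + 1 from rfl,
    contDiffOn_succ_iff_derivWithin (uniqueDiffOn_Icc hr)] at h
  exact h.2.2.congr fun t ht => (derivWithin_fracConv_one hr hf ht).symm

lemma exists_eqOn_fracConv_of_contDiffOn_two (hα₀ : 0 < α) (hα₂ : α < 2) (hr : 0 < r)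
    (hv : ContDiffOn ℝ 1 v (Icc 0 r)) (hv₀ : v 0 = 0)
    (h : ContDiffOn ℝ 2 (fracConv (2 - α) v) (Icc 0 r)) :
    ∃ m : ℝ → X, Continuous m ∧ EqOn v (fracConv α m) (Icc 0 r) := by
  have hα₂' : 0 < 2 - α := sub_pos.2 hα₂
  obtain ⟨q, hq, hvq⟩ := (contDiffOn_one_iff_exists_eqOn_fracConv_one hr hv₀).1 hv
  have hconv : EqOn (fracConv 1 (fracConv (2 - α) q)) (fracConv (2 - α) v) (Icc 0 r) :=
    fun t ht => by
      rw [fracConv_congr _ ht.1 (hvq.mono (Icc_subset_Icc_right ht.2)),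
        fracConv_fracConv hα₂' one_pos hq ht.1, fracConv_fracConv one_pos hα₂' hq ht.1, add_comm]
  obtain ⟨m, hm, hqm⟩ := (contDiffOn_one_iff_exists_eqOn_fracConv_one hr
    (fracConv_apply_zero (2 - α) q)).1 <| contDiffOn_one_of_contDiffOn_two_fracConv_one hr
      (continuous_fracConv hα₂' hq) (h.congr hconv)
  refine ⟨m, hm, hvq.trans ?_⟩
  refine (eqOn_fracConv_iff_eqOn_fracConv_two_sub hα₀ hα₂ hr (continuous_fracConv one_pos hq)
    hm).2 fun t ht => ?_
  rw [← fracConv_congr _ ht.1 (hvq.mono (Icc_subset_Icc_right ht.2)), ← hconv ht]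
  exact fracConv_congr 1 ht.1 (hqm.mono (Icc_subset_Icc_right ht.2))

end IntegratedProblem

section StrongSolution

lemma exists_apply_eq_of_mem_graph {𝕜 X : Type*} [RCLike 𝕜] [NormedAddCommGroup X]
    [NormedSpace 𝕜 X] {A : X →ₗ.[𝕜] X} {p q : X} (h : (p, q) ∈ A.graph) :
    ∃ hp : p ∈ A.domain, A ⟨p, hp⟩ = q := by
  obtain ⟨p, rfl, rfl⟩ := A.mem_graph_iff.1 h
  exact ⟨p.2, rfl⟩

variable {𝕜 X : Type*} [RCLike 𝕜] [NormedAddCommGroup X] [NormedSpace ℝ X] [NormedSpace 𝕜 X]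
  [CompleteSpace X] {α r t : ℝ} {A : X →ₗ.[𝕜] X} {x y : X} {f u m : ℝ → X}

lemma hasDerivAt_affine_add_fracConv_one (x y : X) (hm : Continuous m) (t : ℝ) :
    HasDerivAt (fun t : ℝ => x + t • y + fracConv 1 m t) (y + m t) t := by
  simpa only [one_smul, id] using
    (((hasDerivAt_id t).smul_const y).const_add x).fun_add (hasDerivAt_fracConv_one hm t)

lemma eqOn_fracConv_two_sub_of_eqOn_affine_add_fracConv (hα₀ : 0 < α) (hα₂ : α < 2) (hr : 0 < r)
    (hm : Continuous m) (hu : EqOn u (fun t => x + t • y + fracConv α m t) (Icc 0 r)) :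
    EqOn (fracConv (2 - α) fun s => u s - x - s • y) (fracConv 1 (fracConv 1 m)) (Icc 0 r) := by
  intro t ht
  rw [fracConv_congr _ ht.1 (g := fracConv α m) fun s hs => by
    simp only [hu (Icc_subset_Icc_right ht.2 hs)]; abel]
  exact (eqOn_fracConv_iff_eqOn_fracConv_two_sub hα₀ hα₂ hr (continuous_fracConv hα₀ hm) hm).1
    (eqOn_refl _ _) ht

lemma caputoDeriv_eq_of_eqOn_affine_add_fracConv (hα₀ : 0 < α) (hα₂ : α < 2) (hr : 0 < r)
    (hm : Continuous m) (hu : EqOn u (fun t => x + t • y + fracConv α m t) (Icc 0 r))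
    (hx : u 0 = x) (hy : derivWithin u (Icc 0 r) 0 = y) (ht : t ∈ Icc 0 r) :
    caputoDeriv α r u t = m t := by
  rw [caputoDeriv, hx, hy, iteratedDerivWithin_congr
    (eqOn_fracConv_two_sub_of_eqOn_affine_add_fracConv hα₀ hα₂ hr hm hu) ht,
    iteratedDerivWithin_two_fracConv_one_fracConv_one hr hm ht]

lemma IsStrongSolution.exists_eqOn_affine_add_fracConv (h : IsStrongSolution α r A x y f u)
    (hα₀ : 0 < α) (hα₂ : α < 2) (hr : 0 < r) : ∃ m : ℝ → X, Continuous m ∧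
      (∀ t ∈ Icc 0 r, (u t, m t - f t) ∈ A.graph) ∧
      EqOn u (fun t => x + t • y + fracConv α m t) (Icc 0 r) := by
  set v : ℝ → X := fun s => u s - x - s • y
  have hv : ContDiffOn ℝ 1 v (Icc 0 r) := (h.contDiffOn_one.sub contDiffOn_const).sub
    (contDiff_id.smul contDiff_const).contDiffOn
  obtain ⟨m, hm, hvm⟩ := exists_eqOn_fracConv_of_contDiffOn_two hα₀ hα₂ hr hv
    (by simp [v, h.initial]) h.contDiffOn_two
  have hum : EqOn u (fun t => x + t • y + fracConv α m t) (Icc 0 r) := fun t ht => by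
    simp only [← hvm ht, v]
    abel
  refine ⟨m, hm, fun t ht => ?_, hum⟩
  rw [← caputoDeriv_eq_of_eqOn_affine_add_fracConv hα₀ hα₂ hr hm hum h.initial h.initial_deriv ht,
    h.equation t ht, add_sub_cancel_right]
  exact A.mem_graph ⟨u t, h.mem_domain t ht⟩

lemma isStrongSolution_of_eqOn_affine_add_fracConv (hα₁ : 1 < α) (hα₂ : α < 2) (hr : 0 < r)
    (hf : ContinuousOn f (Icc 0 r)) (hm : Continuous m)
    (hum : ∀ t ∈ Icc 0 r, (u t, m t - f t) ∈ A.graph)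
    (hu : EqOn u (fun t => x + t • y + fracConv α m t) (Icc 0 r)) :
    IsStrongSolution α r A x y f u := by
  have hα₀ : 0 < α := one_pos.trans hα₁
  have h0 : (0 : ℝ) ∈ Icc 0 r := left_mem_Icc.2 hr.le
  have hc : Continuous (fracConv (α - 1) m) := continuous_fracConv (sub_pos.2 hα₁) hm
  have hu' : EqOn u (fun t => x + t • y + fracConv 1 (fracConv (α - 1) m) t) (Icc 0 r) :=
    fun t ht => by simp only [hu ht, fracConv_one_fracConv_sub_one hα₁ hm ht.1]
  have hinitial : u 0 = x := by simp [hu h0, fracConv_apply_zero]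
  have hinitial_deriv : derivWithin u (Icc 0 r) 0 = y := by
    rw [((hasDerivAt_affine_add_fracConv_one x y hc 0).hasDerivWithinAt.congr hu'
      (hu' h0)).derivWithin (uniqueDiffOn_Icc hr 0 h0), fracConv_apply_zero, add_zero]
  have hdom (t) (ht : t ∈ Icc 0 r) : u t ∈ A.domain :=
    (exists_apply_eq_of_mem_graph (hum t ht)).1
  have hA (t) (ht : t ∈ Icc 0 r) : A ⟨u t, hdom t ht⟩ = m t - f t :=
    (exists_apply_eq_of_mem_graph (hum t ht)).2
  refine ⟨hdom, ?_, ?_, (contDiff_two_fracConv_one_fracConv_one hm).contDiffOn.congr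
    (eqOn_fracConv_two_sub_of_eqOn_affine_add_fracConv hα₀ hα₂ hr hm hu),
    hinitial, hinitial_deriv, fun t ht => ?_⟩
  · simp only [hA _ (Subtype.coe_prop _)]
    exact (hm.comp continuous_subtype_val).sub hf.domRestrict
  · exact ((contDiff_const.add (contDiff_id.smul contDiff_const)).add
      (contDiff_one_fracConv_one hc)).contDiffOn.congr hu'
  · rw [hA t ht, sub_add_cancel, caputoDeriv_eq_of_eqOn_affine_add_fracConv hα₀ hα₂ hr hm hu
      hinitial hinitial_deriv ht]

end StrongSolution

section HomogeneousSolution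

variable {𝕜 X : Type*} [RCLike 𝕜] [NormedAddCommGroup X] [NormedSpace ℝ X] [NormedSpace 𝕜 X]
  {α t : ℝ} {A : X →ₗ.[𝕜] X} {S : ℝ → X →L[𝕜] X} {f : ℝ → X} {x x' y y' : X}

/-- The solution `S(t)x + ∫₀ᵗ S(s)y ds` of the homogeneous problem with initial values `x`, `y`. -/
noncomputable def homogeneousSolution (S : ℝ → X →L[𝕜] X) (x y : X) (t : ℝ) : X :=
  S t x + fracConv 1 (fun s => S s y) t

lemma continuous_homogeneousSolution (hc : Continuous fun p : ℝ × X => S p.1 p.2) (x y : X) :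
    Continuous (homogeneousSolution S x y) :=
  (hc.comp (Continuous.prodMk_left x)).add
    (continuous_fracConv one_pos (hc.comp (Continuous.prodMk_left y)))

namespace IsResolventFamily

lemma apply_eq_add_fracConv_of_mem_graph (hS : IsResolventFamily α A S) (ht : 0 ≤ t)
    (hx : (x, x') ∈ A.graph) : S t x = x + fracConv α (fun s => S s x') t := by
  obtain ⟨hxA, rfl⟩ := exists_apply_eq_of_mem_graph hx
  exact hS.resolvent_eq t ht ⟨x, hxA⟩

variable [CompleteSpace X]

lemma fracConv_one_apply_eq_add_fracConv_of_mem_graph (hS : IsResolventFamily α A S)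
    (hc : Continuous fun p : ℝ × X => S p.1 p.2) (hα : 0 < α) (ht : 0 ≤ t)
    (hy : (y, y') ∈ A.graph) : fracConv 1 (fun s => S s y) t =
      t • y + fracConv α (fracConv 1 fun s => S s y') t := by
  have hSy' : Continuous fun s => S s y' := hc.comp (Continuous.prodMk_left y')
  rw [fracConv_congr 1 ht fun s hs => hS.apply_eq_add_fracConv_of_mem_graph hs.1 hy,
    fracConv_add one_pos continuous_const (continuous_fracConv hα hSy'),
    fracConv_fracConv one_pos hα hSy' ht, fracConv_fracConv hα one_pos hSy' ht, add_comm 1 α,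
    fracConv_one fun _ => y, intervalIntegral.integral_const, sub_zero]

lemma homogeneousSolution_eq_affine_add_fracConv (hS : IsResolventFamily α A S)
    (hc : Continuous fun p : ℝ × X => S p.1 p.2) (hα : 0 < α) (ht : 0 ≤ t)
    (hx : (x, x') ∈ A.graph) (hy : (y, y') ∈ A.graph) : homogeneousSolution S x y t =
      x + t • y + fracConv α (homogeneousSolution S x' y') t := by
  have hSx' : Continuous fun s => S s x' := hc.comp (Continuous.prodMk_left x')
  have hSy' : Continuous fun s => S s y' := hc.comp (Continuous.prodMk_left y')
  have hadd : fracConv α (homogeneousSolution S x' y') t =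
      fracConv α (fun s => S s x') t + fracConv α (fracConv 1 fun s => S s y') t :=
    fracConv_add hα hSx' (continuous_fracConv one_pos hSy') t
  rw [homogeneousSolution, hadd, hS.apply_eq_add_fracConv_of_mem_graph ht hx,
    hS.fracConv_one_apply_eq_add_fracConv_of_mem_graph hc hα ht hy]
  abel

variable [IsScalarTower ℝ 𝕜 X]

lemma homogeneousSolution_mem_graph (hS : IsResolventFamily α A S)
    (hc : Continuous fun p : ℝ × X => S p.1 p.2) (ht : 0 ≤ t) (hx : (x, x') ∈ A.graph)
    (hy : (y, y') ∈ A.graph) :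
    (homogeneousSolution S x y t, homogeneousSolution S x' y' t) ∈ A.graph :=
  A.graph.add_mem (hS.apply_mem_graph ht hx) <| fracConv_mem_graph hS.isClosed one_pos
    (hc.comp (Continuous.prodMk_left y)) (hc.comp (Continuous.prodMk_left y')) ht
    fun _ hs => hS.apply_mem_graph hs.1 hy

end IsResolventFamily

variable [IsScalarTower ℝ 𝕜 X] [CompleteSpace X]

lemma candidateSolution_eq_homogeneousSolution_add_fracConv
    (hc : Continuous fun p : ℝ × X => S p.1 p.2) (hα : 1 < α) (hf : Continuous f) (ht : 0 ≤ t)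
    (x y : X) : candidateSolution α S x y f t =
      homogeneousSolution S x y t + fracConv (α - 1) (opConv S f) t := by
  simp only [candidateSolution, homogeneousSolution, resolventP, fracConv_one,
    fracConv_opConv_eq_integral hc (sub_pos.2 hα) hf ht]

end HomogeneousSolution

section Characterization

variable {𝕜 X : Type*} [RCLike 𝕜] [NormedAddCommGroup X] [NormedSpace ℝ X] [NormedSpace 𝕜 X]
  [IsScalarTower ℝ 𝕜 X] [CompleteSpace X] {α r : ℝ} {A : X →ₗ.[𝕜] X} {S : ℝ → X →L[𝕜] X}
  {f k u : ℝ → X} {x y : X}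

lemma candidateSolution_eq_of_eqOn_fracConv_one (hc : Continuous fun p : ℝ × X => S p.1 p.2)
    (hα : 1 < α) (hf : Continuous f) (hk : Continuous k)
    (h : EqOn (opConv S f) (fracConv 1 k) (Icc 0 r)) (x y : X) :
    EqOn (candidateSolution α S x y f) (fun t => homogeneousSolution S x y t + fracConv α k t)
      (Icc 0 r) := by
  intro t ht
  simp only [candidateSolution_eq_homogeneousSolution_add_fracConv hc hα hf ht.1,
    fracConv_congr (α - 1) ht.1 (h.mono (Icc_subset_Icc_right ht.2)),
    fracConv_fracConv (sub_pos.2 hα) one_pos hk ht.1, sub_add_cancel]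

/-- Subtracting the homogeneous solution reduces to zero initial values, where `u = g_α * k`
solves the problem exactly when `S * f = 1 * k`. -/
lemma IsResolventFamily.isStrongSolution_iff_of_continuous (hS : IsResolventFamily α A S)
    (hc : Continuous fun p : ℝ × X => S p.1 p.2) (hα₁ : 1 < α) (hα₂ : α < 2) (hr : 0 < r)
    (hx : x ∈ A.domain) (hy : y ∈ A.domain) (hf : Continuous f) :
    IsStrongSolution α r A x y f u ↔
      ContDiffOn ℝ 1 (opConv S f) (Icc 0 r) ∧ EqOn u (candidateSolution α S x y f) (Icc 0 r) := by
  have hα₀ : 0 < α := one_pos.trans hα₁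
  obtain ⟨x', hx⟩ := LinearPMap.mem_domain_iff.1 hx
  obtain ⟨y', hy⟩ := LinearPMap.mem_domain_iff.1 hy
  have hm₀ : Continuous (homogeneousSolution S x' y') := continuous_homogeneousSolution hc x' y'
  have hgraph (t) (ht : t ∈ Icc 0 r) := hS.homogeneousSolution_mem_graph hc ht.1 hx hy
  have hhom (t) (ht : t ∈ Icc 0 r) :=
    hS.homogeneousSolution_eq_affine_add_fracConv hc hα₀ ht.1 hx hy
  rw [contDiffOn_one_iff_exists_eqOn_fracConv_one hr (opConv_apply_zero S f)]
  constructor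
  · intro h
    obtain ⟨m, hm, hum, hu⟩ := h.exists_eqOn_affine_add_fracConv hα₀ hα₂ hr
    set k : ℝ → X := fun t => m t - homogeneousSolution S x' y' t
    have hk : Continuous k := hm.sub hm₀
    have huk : EqOn u (fun t => homogeneousSolution S x y t + fracConv α k t) (Icc 0 r) :=
      fun t ht => by simp only [hu ht, hhom t ht, k, fracConv_sub hα₀ hm hm₀]; abel
    have hSk : EqOn (opConv S f) (fracConv 1 k) (Icc 0 r) := fun t ht => by
      refine hS.opConv_eq_fracConv_one_of_mem_graph hc hα₀ hf hk ht.1 fun s hs => ?_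
      have hs' : s ∈ Icc 0 r := Icc_subset_Icc_right ht.2 hs
      simpa only [Prod.mk_sub_mk, huk hs', add_sub_cancel_left, sub_right_comm _ (f s)] using
        A.graph.sub_mem (hum s hs') (hgraph s hs')
    exact ⟨⟨k, hk, hSk⟩,
      huk.trans (candidateSolution_eq_of_eqOn_fracConv_one hc hα₁ hf hk hSk x y).symm⟩
  · rintro ⟨⟨k, hk, hSk⟩, hu⟩
    have huk := hu.trans (candidateSolution_eq_of_eqOn_fracConv_one hc hα₁ hf hk hSk x y)
    refine isStrongSolution_of_eqOn_affine_add_fracConv hα₁ hα₂ hr hf.continuousOn (hm₀.add hk)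
      (fun t ht => ?_) fun t ht => ?_
    · simpa only [Prod.mk_add_mk, huk ht, Pi.add_apply, add_sub_assoc] using
        A.graph.add_mem (hgraph t ht)
          (hS.mem_graph_of_opConv_eq_fracConv_one hc hα₀ hr hf hk hSk t ht)
    · have hadd := fracConv_add hα₀ hm₀ hk t
      simp only [huk ht, hhom t ht, Pi.add_def, hadd, add_assoc]

end Characterization

section StrongContinuity

variable {𝕜 X : Type*} [RCLike 𝕜] [NormedAddCommGroup X] [NormedSpace 𝕜 X]
  {S : ℝ → X →L[𝕜] X}

lemma continuous_uncurry_of_forall_continuous_apply {P Z : Type*} [TopologicalSpace P]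
    [WeaklyLocallyCompactSpace P] [NormedAddCommGroup Z] [NormedSpace 𝕜 Z] [CompleteSpace X]
    {T : P → X →L[𝕜] Z} (hT : ∀ x, Continuous fun p => T p x) :
    Continuous fun p : P × X => T p.1 p.2 := by
  rw [continuous_iff_continuousAt]
  rintro ⟨p₀, x₀⟩
  obtain ⟨K, hK, hK₀⟩ := exists_compact_mem_nhds p₀
  obtain ⟨C, hC⟩ : ∃ C, ∀ p : K, ‖T p‖ ≤ C := banach_steinhaus fun x => by
    obtain ⟨C, hC⟩ := hK.exists_bound_of_continuousOn (hT x).continuousOn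
    exact ⟨C, fun p => hC p p.2⟩
  refine (continuousOn_prod_of_continuousOn_lipschitzOnWith' (s := K) (t := univ)
    (fun p : P × X => T p.1 p.2) C.toNNReal (fun p hp => ?_) fun x _ =>
      (hT x).continuousOn).continuousAt (prod_mem_nhds hK₀ univ_mem)
  exact ((T p).lipschitz.weaken (NNReal.le_toNNReal_of_coe_le (hC ⟨p, hp⟩))).lipschitzOnWith

/-- The family `t ↦ S (max t 0)`, which has the same values as `S` on `[0,∞)` and is strongly
continuous on the whole line, so that the convolution calculus applies to it. -/
def clampedFamily (S : ℝ → X →L[𝕜] X) (t : ℝ) : X →L[𝕜] X := S (max t 0)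

lemma eqOn_clampedFamily (S : ℝ → X →L[𝕜] X) : EqOn S (clampedFamily S) (Ici 0) := fun t ht => by
  rw [clampedFamily, max_eq_left ht]

lemma continuous_uncurry_clampedFamily [CompleteSpace X]
    (hS : ∀ x, ContinuousOn (fun t => S t x) (Ici 0)) :
    Continuous fun p : ℝ × X => clampedFamily S p.1 p.2 :=
  continuous_uncurry_of_forall_continuous_apply fun x =>
    (hS x).comp_continuous (by fun_prop : Continuous fun t : ℝ => max t 0) fun t => le_max_right t 0

variable [NormedSpace ℝ X] {α r : ℝ} {A : X →ₗ.[𝕜] X} {x y : X} {f g u : ℝ → X}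

lemma isResolventFamily_clampedFamily (hS : IsResolventFamily α A S) :
    IsResolventFamily α A (clampedFamily S) where
  isClosed := hS.isClosed
  dense_domain := hS.dense_domain
  strongly_continuous x := (hS.strongly_continuous x).congr fun t ht => by
    simp only [eqOn_clampedFamily S ht]
  map_zero := by rw [← eqOn_clampedFamily S self_mem_Ici, hS.map_zero]
  commutes t ht x := by
    rw [← eqOn_clampedFamily S ht]
    exact hS.commutes t ht x
  resolvent_eq t ht x := by
    rw [← eqOn_clampedFamily S ht, hS.resolvent_eq t ht x]
    congr 1
    exact fracConv_congr α ht fun s hs => by rw [eqOn_clampedFamily S hs.1]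

lemma eqOn_candidateSolution_clampedFamily (hfg : EqOn f g (Icc 0 r)) (x y : X) :
    EqOn (candidateSolution α S x y f) (candidateSolution α (clampedFamily S) x y g)
      (Icc 0 r) := by
  intro t ht
  have hsub : uIcc 0 t ⊆ Icc 0 t := (uIcc_of_le ht.1).subset
  simp only [candidateSolution, eqOn_clampedFamily S ht.1]
  congr 1
  · congr 1
    exact intervalIntegral.integral_congr fun s hs => by rw [eqOn_clampedFamily S (hsub hs).1]
  · refine intervalIntegral.integral_congr fun s hs => ?_
    simp only [resolventP, hfg (Icc_subset_Icc_right ht.2 (hsub hs))]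
    exact fracConv_congr _ (sub_nonneg.2 (hsub hs).2) fun σ hσ => by
      rw [eqOn_clampedFamily S hσ.1]

lemma eqOn_opConv_clampedFamily (hfg : EqOn f g (Icc 0 r)) :
    EqOn (opConv S f) (opConv (clampedFamily S) g) (Icc 0 r) := fun _ ht =>
  opConv_congr ht.1 ((eqOn_clampedFamily S).mono Icc_subset_Ici_self)
    (hfg.mono (Icc_subset_Icc_right ht.2))

lemma IsStrongSolution.congr_right (h : IsStrongSolution α r A x y f u)
    (hfg : EqOn f g (Icc 0 r)) : IsStrongSolution α r A x y g u :=
  { h with equation := fun t ht => by rw [← hfg ht, h.equation t ht] }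

variable [IsScalarTower ℝ 𝕜 X] [CompleteSpace X]

theorem IsResolventFamily.isStrongSolution_iff (hS : IsResolventFamily α A S) (hα₁ : 1 < α)
    (hα₂ : α < 2) (hr : 0 < r) (hx : x ∈ A.domain) (hy : y ∈ A.domain)
    (hf : ContinuousOn f (Icc 0 r)) : IsStrongSolution α r A x y f u ↔
      ContDiffOn ℝ 1 (opConv S f) (Icc 0 r) ∧ EqOn u (candidateSolution α S x y f) (Icc 0 r) := by
  obtain ⟨g, hg, hfg⟩ := exists_continuous_eqOn_Icc hr.le hf
  have hcand := eqOn_candidateSolution_clampedFamily (α := α) (S := S) hfg x y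
  have hu : EqOn u (candidateSolution α S x y f) (Icc 0 r) ↔
      EqOn u (candidateSolution α (clampedFamily S) x y g) (Icc 0 r) :=
    ⟨fun h => h.trans hcand, fun h => h.trans hcand.symm⟩
  rw [contDiffOn_congr (eqOn_opConv_clampedFamily hfg), hu,
    ← (isResolventFamily_clampedFamily hS).isStrongSolution_iff_of_continuous
      (continuous_uncurry_clampedFamily hS.strongly_continuous) hα₁ hα₂ hr hx hy hg]
  exact ⟨fun h => h.congr_right hfg, fun h => h.congr_right hfg.symm⟩

theorem hasBoundedSemivariation_iff_forall_continuousOn_contDiffOn_opConv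
    (hS : ∀ x, ContinuousOn (fun t => S t x) (Ici 0)) (hr : 0 < r) :
    HasBoundedSemivariation 0 r S ↔
      ∀ f, ContinuousOn f (Icc 0 r) → ContDiffOn ℝ 1 (opConv S f) (Icc 0 r) := by
  rw [HasBoundedSemivariation,
    semivariation_congr ((eqOn_clampedFamily S).mono Icc_subset_Ici_self)]
  refine (hasBoundedSemivariation_iff_forall_contDiffOn_opConv
    (continuous_uncurry_clampedFamily hS) hr).trans ⟨fun h f hf => ?_, fun h f hf => ?_⟩
  · obtain ⟨g, hg, hfg⟩ := exists_continuous_eqOn_Icc hr.le hf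
    exact (h g hg).congr (eqOn_opConv_clampedFamily hfg)
  · exact (h f hf.continuousOn).congr (eqOn_opConv_clampedFamily (eqOn_refl f _)).symm

end StrongContinuity

theorem mainTheorem1 {𝕜 X : Type*} [RCLike 𝕜] [NormedAddCommGroup X]
    [NormedSpace ℝ X] [NormedSpace 𝕜 X] [IsScalarTower ℝ 𝕜 X] [CompleteSpace X]
    (α r : ℝ) (hα₁ : 1 < α) (hα₂ : α < 2) (hr : 0 < r)
    (A : X →ₗ.[𝕜] X) (S : ℝ → X →L[𝕜] X) (hS : IsResolventFamily α A S) :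
    ((∀ x ∈ A.domain, ∀ y ∈ A.domain, ∀ f : ℝ → X, ContinuousOn f (Icc 0 r) →
        IsStrongSolution α r A x y f (candidateSolution α S x y f)) ↔
      HasBoundedSemivariation 0 r S) ∧
    (HasMaximalRegularity α r A ↔ HasBoundedSemivariation 0 r S) := by
  have hzero : (0 : X) ∈ A.domain := A.domain.zero_mem
  rw [hasBoundedSemivariation_iff_forall_continuousOn_contDiffOn_opConv hS.strongly_continuous hr]
  refine ⟨⟨fun h f hf => ?_, fun h x hx y hy f hf => ?_⟩,
    fun h f hf => ?_, fun h x hx y hy f hf => ?_⟩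
  · exact ((hS.isStrongSolution_iff hα₁ hα₂ hr hzero hzero hf).1 (h 0 hzero 0 hzero f hf)).1
  · exact (hS.isStrongSolution_iff hα₁ hα₂ hr hx hy hf).2 ⟨h f hf, eqOn_refl _ _⟩
  · obtain ⟨u, hu, -⟩ := h 0 hzero 0 hzero f hf
    exact ((hS.isStrongSolution_iff hα₁ hα₂ hr hzero hzero hf).1 hu).1
  · exact ⟨_, (hS.isStrongSolution_iff hα₁ hα₂ hr hx hy hf).2 ⟨h f hf, eqOn_refl _ _⟩,
      fun v hv => ((hS.isStrongSolution_iff hα₁ hα₂ hr hx hy hf).1 hv).2⟩
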